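/- Let $\mathcal C$ be a rigid C*-tensor category, closed under finite direct sums and subobjects, with simple unit object $\mathbb 1$ (i.e. $\operatorname{End}(\mathbb 1)=\mathbb C$) and at most countably many isomorphism classes of simple objects. Let $\mathrm{Irr}\ni\mathbb 1$ be a set of representatives of these classes. For every $w\in\mathrm{Irr}$ let $\bar w\in\mathrm{Irr}$ be its conjugate and fix a standard solution $R_w\colon\mathbb 1\to\bar w\otimes w$, $\bar R_w\colon\mathbb 1\to w\otimes\bar w$ of the conjugate equations. For every object $z$ and $w\in\mathrm{Irr}$ fix an orthonormal basis of $\mathcal C(w,z)$ for the inner product $\tau^*\sigma=\langle\sigma,\tau\rangle 1_w$; for given $z$, only finitely many of these spaces are nonzero. (Such choices exist, and the following holds for all of them.) The fusion algebra $\mathbb C[\mathcal C]$ is the complex vector space with basis $\mathrm{Irr}$, product $x\cdot y=\sum_{z\in\mathrm{Irr}}\dim\mathcal C(z,x\otimes y)\,z$ and conjugate-linear involution $x\mapsto x^*=\bar x$ on basis elements. The tube algebra is $\mathcal A=\bigoplus_{x,y\in\mathrm{Irr}}\mathcal A_{x,y}$, where $\mathcal A_{x,y}=\bigoplus_{w\in\mathrm{Irr}}\mathcal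 C(w\otimes x,y\otimes w)$. For an object $z$ and $\gamma\in\mathcal C(z\otimes x,y\otimes z)$, let $\Psi^z_{x,y}(\gamma)\in\mathcal A_{x,y}$ be the element with components $\sum_\alpha(1_y\otimes\alpha^*)\gamma(\alpha\otimes 1_x)$, $w\in\mathrm{Irr}$, where $\alpha$ runs over the orthonormal basis of $\mathcal C(w,z)$. For $\gamma_1\in\mathcal C(m\otimes x_1,y_1\otimes m)$ and $\gamma_2\in\mathcal C(l\otimes x_2,y_2\otimes l)$ with $m,l\in\mathrm{Irr}$, the product $\gamma_1\cdot\gamma_2$ is $\Psi^{m\otimes l}_{x_2,y_1}\big((\gamma_1\otimes 1_l)(1_m\otimes\gamma_2)\big)$ if $x_1=y_2$ and $0$ otherwise. The involution sends $\gamma\in\mathcal C(w\otimes x,y\otimes w)$ to $(R_w^*\otimes 1_x\otimes 1_{\bar w})(1_{\bar w}\otimes\gamma^*\otimes 1_{\bar w})(1_{\bar w}\otimes 1_y\otimes\bar R_w)\in\mathcal C(\bar w\otimes y,x\otimes\bar w)$. (Associativity and unit isomorphisms are suppressed.) **Theorem.** (1) $\mathbb C[\mathcal C]$ is a unital $*$-algebra,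 and the linear map with $w\mapsto\Psi^w_{\mathbb 1,\mathbb 1}(1_w)$ for $w\in\mathrm{Irr}$ is an injective $*$-homomorphism from $\mathbb C[\mathcal C]$ into $\mathcal A$ with image the corner $\mathcal A_{\mathbb 1,\mathbb 1}$; it sends the unit to $1_{\mathbb 1}\in\mathcal C(\mathbb 1\otimes\mathbb 1,\mathbb 1\otimes\mathbb 1)$. (2) The tube cone $$\Sigma^2\mathcal C=\Big\{\sum_{i=1}^n a_ia_i^*\ :\ n\in\mathbb N,\ a_i\in\bigcup_{x\in\mathrm{Irr}}\mathcal A_{x,\mathbb 1}\Big\}$$ is contained in $\mathcal A_{\mathbb 1,\mathbb 1}$ and, under the identification in (1), is a $*$-positive cone of $\mathbb C[\mathcal C]$: it consists of self-adjoint elements, contains $\mathbb R_{\ge 0}\,\mathbb 1$, contains $\lambda a+b$ whenever $a,b\in\Sigma^2\mathcal C$ and $\lambda\ge 0$, and contains $x^*ax$ whenever $a\in\Sigma^2\mathcal C$ and $x\in\mathbb C[\mathcal C]$. (3) $\mathbb C[\mathcal C]$ is a semi-pre-C*-algebra with respect to $\Sigma^2\mathcal C$: for every $b\in\mathbb C[\mathcal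 C]$ there is a real $R>0$ such that $R\,\mathbb 1-b^*b\in\Sigma^2\mathcal C$. -/

import Mathlib

open CategoryTheory MonoidalCategory

namespace TubeCone

universe v u

/-! ### C*-tensor categories -/

/-- A C*-category: a `ℂ`-linear category with Banach spaces of morphisms, a submultiplicative norm
and an involution `f ↦ f*` on morphisms satisfying the C*-identity, such that every `f* f` is
positive in `End X`. Composition is written in diagrammatic order, so `f ≫ adj f` is `f* f`. -/
class CStarCategory (C : Type u) [Category.{v} C] [Preadditive C] [Linear ℂ C] where
  /-- the adjoint `f*` of a morphism -/
  adj : ∀ {X Y : C}, (X ⟶ Y) → (Y ⟶ X)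
  adj_adj : ∀ {X Y : C} (f : X ⟶ Y), adj (adj f) = f
  adj_add : ∀ {X Y : C} (f g : X ⟶ Y), adj (f + g) = adj f + adj g
  adj_smul : ∀ {X Y : C} (c : ℂ) (f : X ⟶ Y), adj (c • f) = star c • adj f
  adj_comp : ∀ {X Y Z : C} (f : X ⟶ Y) (g : Y ⟶ Z), adj (f ≫ g) = adj g ≫ adj f
  /-- the norm of a morphism -/
  homNorm : ∀ {X Y : C}, (X ⟶ Y) → ℝ
  eq_zero_of_homNorm_eq_zero : ∀ {X Y : C} (f : X ⟶ Y), homNorm f = 0 → f = 0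
  homNorm_add_le : ∀ {X Y : C} (f g : X ⟶ Y), homNorm (f + g) ≤ homNorm f + homNorm g
  homNorm_smul : ∀ {X Y : C} (c : ℂ) (f : X ⟶ Y), homNorm (c • f) = ‖c‖ * homNorm f
  homNorm_complete : ∀ {X Y : C} (a : ℕ → (X ⟶ Y)),
    (∀ ε : ℝ, 0 < ε → ∃ N, ∀ m n, N ≤ m → N ≤ n → homNorm (a m - a n) < ε) →
    ∃ f : X ⟶ Y, ∀ ε : ℝ, 0 < ε → ∃ N, ∀ n, N ≤ n → homNorm (a n - f) < ε
  homNorm_comp_le : ∀ {X Y Z : C} (f : X ⟶ Y) (g : Y ⟶ Z),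
    homNorm (f ≫ g) ≤ homNorm f * homNorm g
  homNorm_adj_mul_self : ∀ {X Y : C} (f : X ⟶ Y), homNorm (f ≫ adj f) = homNorm f ^ 2
  adj_mul_self_pos : ∀ {X Y : C} (f : X ⟶ Y), ∃ g : X ⟶ X, f ≫ adj f = g ≫ adj g

open CStarCategory (adj)

/-- A C*-tensor category (not necessarily strict, with unitary associativity and unit
constraints), closed under finite direct sums and under passage to subobjects. -/
class CStarTensorCategory (C : Type u) [Category.{v} C] [Preadditive C] [Linear ℂ C]
    [MonoidalCategory C] [MonoidalPreadditive C] [MonoidalLinear ℂ C]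
    extends CStarCategory C where
  adj_whiskerLeft : ∀ (X : C) {Y Z : C} (f : Y ⟶ Z), adj (X ◁ f) = X ◁ adj f
  adj_whiskerRight : ∀ {Y Z : C} (f : Y ⟶ Z) (X : C), adj (f ▷ X) = adj f ▷ X
  adj_associator : ∀ X Y Z : C, adj (α_ X Y Z).hom = (α_ X Y Z).inv
  adj_leftUnitor : ∀ X : C, adj (λ_ X).hom = (λ_ X).inv
  adj_rightUnitor : ∀ X : C, adj (ρ_ X).hom = (ρ_ X).inv
  exists_directSum : ∀ X Y : C, ∃ (Z : C) (i : X ⟶ Z) (j : Y ⟶ Z),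
    i ≫ adj i = 𝟙 X ∧ j ≫ adj j = 𝟙 Y ∧ adj i ≫ i + adj j ≫ j = 𝟙 Z
  exists_subobject : ∀ {X : C} (p : X ⟶ X), p ≫ p = p → adj p = p →
    ∃ (Y : C) (i : Y ⟶ X), i ≫ adj i = 𝟙 Y ∧ adj i ≫ i = p

section

variable {C : Type u} [Category.{v} C] [Preadditive C] [Linear ℂ C]

/-- An object of a C*-category is simple if it is nonzero and its only endomorphisms are the
scalars. -/
def IsSimple (X : C) : Prop :=
  ∀ f : X ⟶ X, ∃! c : ℂ, f = c • 𝟙 X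

theorem IsSimple.of_iso {X Y : C} (e : X ≅ Y) (hX : IsSimple X) : IsSimple Y := by
  intro f
  obtain ⟨c, hc, huniq⟩ := hX (e.hom ≫ f ≫ e.inv)
  have key : ∀ d : ℂ, f = d • 𝟙 Y ↔ e.hom ≫ f ≫ e.inv = d • 𝟙 X := by
    intro d
    constructor
    · rintro rfl
      simp
    · intro h
      have h2 : e.inv ≫ (e.hom ≫ f ≫ e.inv) ≫ e.hom = f := by simp
      rw [← h2, h]
      simp
  exact ⟨c, (key c).2 hc, fun d hd => huniq d ((key d).1 hd)⟩

variable [MonoidalCategory C]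

variable (C) in
/-- The index set of a system of representatives of the isomorphism classes of simple objects,
for a category with simple unit object; the class of the unit object is the index `one`, and all
other classes of simple objects are `other c _ _`. -/
inductive Irr : Type u
  | one : Irr
  | other (c : Quotient (isIsomorphicSetoid C)) (simple : IsSimple c.out)
      (ne : c ≠ Quotient.mk _ (𝟙_ C)) : Irr

noncomputable instance : DecidableEq (Irr C) := Classical.decEq _

/-- The chosen representatives; the unit object represents its own class. -/
noncomputable def Irr.obj : Irr C → C
  | .one => 𝟙_ C
  | .other c _ _ => c.out

theorem Irr.isSimple_obj (h1 : IsSimple (𝟙_ C)) (i : Irr C) : IsSimple i.obj := by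
  cases i with
  | one => exact h1
  | other c simple ne => exact simple

/-- Every simple object is isomorphic to exactly one of the representatives. -/
theorem Irr.existsUnique (X : C) (hX : IsSimple X) : ∃! i : Irr C, Nonempty (X ≅ i.obj) := by
  have hout : Nonempty ((Quotient.mk (isIsomorphicSetoid C) X).out ≅ X) :=
    Quotient.exact (Quotient.out_eq (Quotient.mk (isIsomorphicSetoid C) X))
  by_cases h : Quotient.mk (isIsomorphicSetoid C) X = Quotient.mk _ (𝟙_ C)
  · refine ⟨.one, Quotient.exact h, ?_⟩
    rintro (_ | ⟨c, hc, hne⟩) hi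
    · rfl
    · exfalso
      apply hne
      rw [← h, ← Quotient.out_eq c]
      exact (Quotient.sound hi).symm
  · refine ⟨.other (Quotient.mk _ X) (hX.of_iso hout.some.symm) h, ⟨hout.some.symm⟩, ?_⟩
    rintro (_ | ⟨c, hc, hne⟩) hi
    · exact absurd (Quotient.sound hi) h
    · have : c = Quotient.mk _ X := by
        rw [← Quotient.out_eq c]
        exact (Quotient.sound hi).symm
      subst this
      rfl

end

section

variable {C : Type u} [Category.{v} C] [Preadditive C] [Linear ℂ C]
  [MonoidalCategory C] [MonoidalPreadditive C] [MonoidalLinear ℂ C] [CStarTensorCategory C]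

/-! ### Rigidity -/

/-- A solution `(R, Rbar)` of the conjugate equations for the pair `(X, Y)`. -/
structure ConjugateSolution (X Y : C) where
  R : 𝟙_ C ⟶ Y ⊗ X
  Rbar : 𝟙_ C ⟶ X ⊗ Y
  /-- `(1_Y ⊗ Rbar*) (R ⊗ 1_Y) = 1_Y` -/
  conj_left : (λ_ Y).inv ≫ R ▷ Y ≫ (α_ Y X Y).hom ≫ Y ◁ adj Rbar ≫ (ρ_ Y).hom = 𝟙 Y
  /-- `(1_X ⊗ R*) (Rbar ⊗ 1_X) = 1_X` -/
  conj_right : (λ_ X).inv ≫ Rbar ▷ X ≫ (α_ X Y X).hom ≫ X ◁ adj R ≫ (ρ_ X).hom = 𝟙 X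

/-- A standard solution: `R* (1 ⊗ f) R = Rbar* (f ⊗ 1) Rbar` for all `f ∈ End X`. -/
def ConjugateSolution.IsStandard {X Y : C} (r : ConjugateSolution X Y) : Prop :=
  ∀ f : X ⟶ X, r.R ≫ Y ◁ f ≫ adj r.R = r.Rbar ≫ f ▷ Y ≫ adj r.Rbar

variable (C) in
/-- The category is rigid if every object has a conjugate. -/
def IsRigid : Prop :=
  ∀ X : C, ∃ Y : C, Nonempty (ConjugateSolution X Y)

/-! ### The choices entering the tube algebra -/

variable (C) in
/-- The auxiliary choices in the construction of the tube algebra: a standard solution of the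
conjugate equations for every simple object `k` and its conjugate, and an orthonormal basis of every
morphism space `C(k, z)` with `k` simple, for the inner product `τ* σ = ⟨σ, τ⟩ 1_k`; only finitely
many simple objects `k` have a nonzero morphism to a given object `z`. -/
structure TubeChoices where
  /-- the conjugate of a simple object -/
  conj : Irr C → Irr C
  sol : ∀ k : Irr C, ConjugateSolution k.obj (conj k).obj
  sol_standard : ∀ k, (sol k).IsStandard
  /-- the number of elements of the orthonormal basis of `C(k, z)` -/
  card : Irr C → C → ℕ
  /-- the orthonormal basis of `C(k, z)` -/
  onb : ∀ (k : Irr C) (z : C), Fin (card k z) → (k.obj ⟶ z)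
  onb_orthonormal : ∀ (k : Irr C) (z : C) (a b : Fin (card k z)),
    onb k z a ≫ adj (onb k z b) = if a = b then 𝟙 k.obj else 0
  onb_span : ∀ (k : Irr C) (z : C), Submodule.span ℂ (Set.range (onb k z)) = ⊤
  finite_card : ∀ z : C, {k : Irr C | card k z ≠ 0}.Finite

namespace TubeChoices

variable (D : TubeChoices C)

/-- The finite set of simple objects `k` with `C(k, z) ≠ 0`. -/
noncomputable def supp (z : C) : Finset (Irr C) :=
  (D.finite_card z).toFinset

/-! ### The fusion algebra -/

/-- The fusion algebra: the vector space with basis the simple objects. -/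
def FusionAlgebra (_D : TubeChoices C) : Type u := Irr C →₀ ℂ

noncomputable instance : AddCommGroup D.FusionAlgebra := inferInstanceAs (AddCommGroup (Irr C →₀ ℂ))

noncomputable instance : Module ℂ D.FusionAlgebra := inferInstanceAs (Module ℂ (Irr C →₀ ℂ))

/-- The basis vector `[x]` of the fusion algebra. -/
noncomputable def basis (x : Irr C) : D.FusionAlgebra :=
  Finsupp.single (M := ℂ) x 1

/-- `[x] · [y] = ∑ z, (dim C(z, x ⊗ y)) [z]`, extended bilinearly. -/
noncomputable instance : Mul D.FusionAlgebra where
  mul a b := Finsupp.sum (M := ℂ) a fun x s => Finsupp.sum (M := ℂ) b fun y t =>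
    (s * t) • ∑ z ∈ D.supp (x.obj ⊗ y.obj),
      (Module.finrank ℂ (z.obj ⟶ x.obj ⊗ y.obj) : ℂ) • D.basis z

noncomputable instance : One D.FusionAlgebra where
  one := D.basis .one

/-- `[x]* = [xbar]`, extended conjugate-linearly. -/
noncomputable instance : Star D.FusionAlgebra where
  star a := Finsupp.sum (M := ℂ) a fun x s => star s • D.basis (D.conj x)

/-! ### The tube algebra -/

open scoped DirectSum

/-- The space `A_{x,y} = ⨁_w C(w ⊗ x, y ⊗ w)`. -/
abbrev TubeSpace (x y : Irr C) : Type (max u v) :=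
  ⨁ w : Irr C, (w.obj ⊗ x.obj ⟶ y.obj ⊗ w.obj)

/-- `γ ↦ (1_y ⊗ α*) γ (α ⊗ 1_x)` for `α : w ⟶ z`. -/
noncomputable def compress (x y : Irr C) {w z : C} (α : w ⟶ z) :
    (z ⊗ x.obj ⟶ y.obj ⊗ z) →ₗ[ℂ] (w ⊗ x.obj ⟶ y.obj ⊗ w) where
  toFun γ := α ▷ x.obj ≫ γ ≫ y.obj ◁ adj α
  map_add' _ _ := by simp
  map_smul' _ _ := by simp

/-- The canonical map `Ψ^z_{x,y} : C(z ⊗ x, y ⊗ z) → A_{x,y}`, whose component at `w` is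
`∑ (1_y ⊗ α*) γ (α ⊗ 1_x)`, the sum over an orthonormal basis of `C(w, z)`. -/
noncomputable def psi (x y : Irr C) (z : C) :
    (z ⊗ x.obj ⟶ y.obj ⊗ z) →ₗ[ℂ] TubeSpace x y :=
  ∑ w ∈ D.supp z, (DirectSum.lof ℂ (Irr C) (fun w => (w.obj ⊗ x.obj ⟶ y.obj ⊗ w.obj)) w).comp
    (∑ a : Fin (D.card w z), compress x y (D.onb w z a))

/-- `(γ₁ ⊗ 1_l) (1_m ⊗ γ₂)` as a morphism `(m ⊗ l) ⊗ x ⟶ y ⊗ (m ⊗ l)`. -/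
noncomputable def juxtapose (x s y : Irr C) (m l : C) :
    (m ⊗ s.obj ⟶ y.obj ⊗ m) →ₗ[ℂ] (l ⊗ x.obj ⟶ s.obj ⊗ l) →ₗ[ℂ]
      ((m ⊗ l) ⊗ x.obj ⟶ y.obj ⊗ (m ⊗ l)) :=
  LinearMap.mk₂ ℂ
    (fun γ₁ γ₂ => (α_ m l x.obj).hom ≫ m ◁ γ₂ ≫ (α_ m s.obj l).inv ≫ γ₁ ▷ l ≫ (α_ y.obj m l).hom)
    (by intros; simp) (by intros; simp) (by intros; simp) (by intros; simp)

/-- The product `A_{s,y} × A_{x,s} → A_{x,y}`, determined by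
`γ₁ · γ₂ = Ψ^{m ⊗ l} ((γ₁ ⊗ 1_l) (1_m ⊗ γ₂))` on the components at `m` and `l`. -/
noncomputable def spaceMul (x s y : Irr C) :
    TubeSpace s y →ₗ[ℂ] TubeSpace x s →ₗ[ℂ] TubeSpace x y :=
  DirectSum.toModule ℂ (Irr C) _ fun m => LinearMap.flip <|
    DirectSum.toModule ℂ (Irr C) _ fun l => LinearMap.flip <|
      (juxtapose x s y m.obj l.obj).compr₂ (D.psi x y (m.obj ⊗ l.obj))

/-- `(R_w* ⊗ 1_x ⊗ 1_wbar) (1_wbar ⊗ γ* ⊗ 1_wbar) (1_wbar ⊗ 1_y ⊗ Rbar_w)`, the image in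
`C(wbar ⊗ y, x ⊗ wbar)` of `γ ∈ C(w ⊗ x, y ⊗ w)`. -/
noncomputable def rotate (x y w : Irr C) :
    (w.obj ⊗ x.obj ⟶ y.obj ⊗ w.obj) →+ ((D.conj w).obj ⊗ y.obj ⟶ x.obj ⊗ (D.conj w).obj) where
  toFun γ :=
    (D.conj w).obj ◁ ((ρ_ y.obj).inv ≫ y.obj ◁ (D.sol w).Rbar ≫
      (α_ y.obj w.obj (D.conj w).obj).inv ≫ adj γ ▷ (D.conj w).obj ≫
      (α_ w.obj x.obj (D.conj w).obj).hom) ≫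
    (α_ (D.conj w).obj w.obj (x.obj ⊗ (D.conj w).obj)).inv ≫
    adj (D.sol w).R ▷ (x.obj ⊗ (D.conj w).obj) ≫ (λ_ (x.obj ⊗ (D.conj w).obj)).hom
  map_zero' := by
    have h : adj (0 : w.obj ⊗ x.obj ⟶ y.obj ⊗ w.obj) = 0 := by
      simpa using CStarCategory.adj_smul (0 : ℂ) (0 : w.obj ⊗ x.obj ⟶ y.obj ⊗ w.obj)
    simp [h]
  map_add' _ _ := by simp [CStarCategory.adj_add]

/-- The involution `A_{x,y} → A_{y,x}`. -/
noncomputable def spaceStar (x y : Irr C) : TubeSpace x y →+ TubeSpace y x :=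
  DirectSum.toAddMonoid fun w =>
    (DirectSum.of (fun w : Irr C => (w.obj ⊗ y.obj ⟶ x.obj ⊗ w.obj)) (D.conj w)).comp
      (D.rotate x y w)

variable (C) in
/-- The vector space `⨁_{x,y} A_{x,y}`. -/
abbrev TubeSum : Type (max u v) :=
  ⨁ p : Irr C × Irr C, TubeSpace p.1 p.2

/-- The inclusion of `A_{x,y}` in the direct sum. -/
noncomputable def sumIncl (x y : Irr C) : TubeSpace x y →ₗ[ℂ] TubeSum C :=
  DirectSum.lof ℂ (Irr C × Irr C) (fun p => TubeSpace p.1 p.2) (x, y)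

/-- The product of `A_{x₁,y₁}` and `A_{x₂,y₂}` in the direct sum; it is zero if `x₁ ≠ y₂`. -/
noncomputable def sumMulAux (x₁ y₁ x₂ y₂ : Irr C) :
    TubeSpace x₁ y₁ →ₗ[ℂ] TubeSpace x₂ y₂ →ₗ[ℂ] TubeSum C :=
  if h : y₂ = x₁ then
    h ▸ (D.spaceMul x₂ y₂ y₁).compr₂ (sumIncl x₂ y₁)
  else 0

/-- The product of the tube algebra, as a bilinear map. -/
noncomputable def sumMul : TubeSum C →ₗ[ℂ] TubeSum C →ₗ[ℂ] TubeSum C :=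
  DirectSum.toModule ℂ (Irr C × Irr C) _ fun p => LinearMap.flip <|
    DirectSum.toModule ℂ (Irr C × Irr C) _ fun q => LinearMap.flip (D.sumMulAux p.1 p.2 q.1 q.2)

/-- The involution of the tube algebra, as an additive map. -/
noncomputable def sumStar : TubeSum C →+ TubeSum C :=
  DirectSum.toAddMonoid fun p => (sumIncl p.2 p.1).toAddMonoidHom.comp (D.spaceStar p.1 p.2)

/-- Ocneanu's tube algebra `A = ⨁_{x,y} A_{x,y}`. -/
def Tube (_D : TubeChoices C) : Type (max u v) := TubeSum C

noncomputable instance : AddCommGroup D.Tube := inferInstanceAs (AddCommGroup (TubeSum C))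

noncomputable instance : Module ℂ D.Tube := inferInstanceAs (Module ℂ (TubeSum C))

noncomputable instance : Mul D.Tube where
  mul a b := D.sumMul a b

noncomputable instance : Star D.Tube where
  star a := D.sumStar a

/-- The inclusion of `A_{x,y}` in the tube algebra. -/
noncomputable def incl (x y : Irr C) : TubeSpace x y →ₗ[ℂ] D.Tube :=
  sumIncl x y

/-- The summand `A_{x,y}` as a subspace of the tube algebra `A`; it is the corner `p_y A p_x`. -/
noncomputable def corner (x y : Irr C) : Submodule ℂ D.Tube :=
  LinearMap.range (D.incl x y)

/-- The projection `p_x`, given by `1_x ∈ C(𝟙 ⊗ x, x ⊗ 𝟙)`. -/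
noncomputable def proj (x : Irr C) : D.Tube :=
  D.incl x x (DirectSum.lof ℂ (Irr C) (fun w => (w.obj ⊗ x.obj ⟶ x.obj ⊗ w.obj)) Irr.one
    ((λ_ x.obj).hom ≫ (ρ_ x.obj).inv))

/-- The linear map from the fusion algebra to the tube algebra with
`w ↦ Ψ^w_{𝟙,𝟙} (1_w)` for all simple objects `w`. -/
noncomputable def fusionToTube : D.FusionAlgebra →ₗ[ℂ] D.Tube :=
  Finsupp.linearCombination ℂ fun w : Irr C =>
    D.incl .one .one (D.psi .one .one w.obj ((ρ_ w.obj).hom ≫ (λ_ w.obj).inv))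

/-- The tube cone in the tube algebra: the finite sums of elements `a a*` with `a ∈ A_{x,𝟙}` for
simple objects `x`. -/
def tubeCone : Set D.Tube :=
  {b | ∃ (n : ℕ) (x : Fin n → Irr C) (a : Fin n → D.Tube),
    (∀ i, a i ∈ D.corner (x i) .one) ∧ b = ∑ i, a i * star (a i)}

/-- The tube cone as a subset of the fusion algebra, under the identification of the latter with
`A_{𝟙,𝟙}`. -/
def fusionCone : Set D.FusionAlgebra :=
  {b | D.fusionToTube b ∈ D.tubeCone}

end TubeChoices

end

/-! ### Semi-pre-C*-algebras -/

section

variable (A : Type*) [AddCommGroup A] [Module ℂ A] [Mul A] [One A] [Star A]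

/-- The given operations make the complex vector space `A` a unital `*`-algebra. -/
structure IsUnitalStarAlgebra : Prop where
  mul_assoc : ∀ a b c : A, a * b * c = a * (b * c)
  one_mul : ∀ a : A, 1 * a = a
  mul_one : ∀ a : A, a * 1 = a
  add_mul : ∀ a b c : A, (a + b) * c = a * c + b * c
  mul_add : ∀ a b c : A, a * (b + c) = a * b + a * c
  smul_mul : ∀ (t : ℂ) (a b : A), (t • a) * b = t • (a * b)
  mul_smul : ∀ (t : ℂ) (a b : A), a * (t • b) = t • (a * b)
  star_star : ∀ a : A, star (star a) = a
  star_add : ∀ a b : A, star (a + b) = star a + star b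
  star_smul : ∀ (t : ℂ) (a : A), star (t • a) = star t • star a
  star_mul : ∀ a b : A, star (a * b) = star b * star a

variable {A}

/-- `P` is a `*`-positive cone of `A`. -/
structure IsStarPositiveCone (P : Set A) : Prop where
  star_eq : ∀ a ∈ P, star a = a
  smul_one_mem : ∀ r : ℝ, 0 ≤ r → (r : ℂ) • (1 : A) ∈ P
  smul_add_mem : ∀ r : ℝ, 0 ≤ r → ∀ a ∈ P, ∀ b ∈ P, (r : ℂ) • a + b ∈ P
  conj_mem : ∀ a ∈ P, ∀ x : A, star x * a * x ∈ P

/-- The elements `x` with `x* x ≤ R 1` for some `R > 0`, where `a ≤ b` means `b - a ∈ P`. -/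
def boundedElements (P : Set A) : Set A :=
  {x | ∃ R : ℝ, 0 < R ∧ (R : ℂ) • (1 : A) - star x * x ∈ P}

/-- `A` is a semi-pre-C*-algebra with respect to `P`: it is a unital `*`-algebra, `P` is a
`*`-positive cone of `A`, and all elements of `A` are bounded. -/
structure IsSemiPreCStarAlgebra (P : Set A) : Prop where
  isUnitalStarAlgebra : IsUnitalStarAlgebra A
  isStarPositiveCone : IsStarPositiveCone P
  boundedElements_eq : boundedElements P = Set.univ

end

end TubeCone

/-!
The tube algebra is analysed through the maps `Ψ^z`. Schur's lemma for simple objects together with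
semisimplicity, `∑ α α* = 1_z` over the orthonormal bases of all `C(k, z)` (`sum_adj_comp_onb`),
gives the trace property `Ψ^{z'} (γ (T ⊗ 1)) = Ψ^z ((1 ⊗ T) γ)` (`psi_cyclic`). From it follow

* `Ψ^z(γ) Ψ^{z'}(γ') = Ψ^{z ⊗ z'} ((γ ⊗ 1) (1 ⊗ γ'))` (`spaceMul_psi`), hence associativity, and
* `Ψ^z(γ)* = Ψ^{z'} (rotated γ*)` for every dual `z'` of `z` (`spaceStar_psi`), hence that the
  involution is antimultiplicative (rotation of a composed tube by the tensor product of two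
  dualities) and involutive (rotation back by the swapped solution of the conjugate equations).

Both rest on identities between string diagrams, proved for arbitrary dualities in a monoidal
category. The corner `A_{𝟙,𝟙}` has the basis `Ψ^w(1_w)`, whose products are
`Ψ^{x ⊗ y}(1) = ∑ dim C(z, x ⊗ y) Ψ^z(1_z)`. So the fusion algebra inherits its `*`-algebra structure
from the tube algebra, and the tube cone is a `*`-positive cone because `x* a a* x = (x* a) (x* a)*`.

For boundedness it suffices, by the parallelogram law, to treat a simple object `k`. Bending the
orthonormal bases of `C(x, kbar ⊗ k)` for all simple `x` yields elements `a ∈ A_{x,𝟙}` for which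
`∑ a a*` is the rotation of `∑ v v* = 1` by a quarter turn, namely the scalar `Rbar* Rbar`
(`sum_bend_mul_star`). The terms with `x = 𝟙` are multiples of `k k*` and do not all vanish, so
`k k*` is a scalar minus an element of the cone (`exists_bound_idTube`).

Existence of the orthonormal bases, and semisimplicity, come from a Pimsner-Popa type estimate: in
a rigid category with simple unit, a nonzero projection `p` on `z` satisfies
`1 ≤ K · R* (1 ⊗ p) R`, so families of orthogonal projections on `z` have bounded size (`exists_card_projections_le`).
Therefore morphism spaces are finite-dimensional, and an object without nontrivial projections is
simple.
-/

namespace TubeCone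

universe v u

/-! ### Duality calculus -/

section Duality

open ExactPairing

variable {C : Type u} [Category.{v} C] [MonoidalCategory C]

/-- The composition of tubes, `(γ₁ ⊗ 1_l) (1_m ⊗ γ₂)`. -/
def tubeComp {x s y m l : C} (γ₁ : m ⊗ s ⟶ y ⊗ m) (γ₂ : l ⊗ x ⟶ s ⊗ l) :
    (m ⊗ l) ⊗ x ⟶ y ⊗ (m ⊗ l) :=
  (α_ m l x).hom ≫ m ◁ γ₂ ≫ (α_ m s l).inv ≫ γ₁ ▷ l ≫ (α_ y m l).hom

/-- Naturality of the composition of tubes; the strands `m` and `l` are slid past each other. -/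
theorem tubeComp_conj {x s y m l m' l' : C} (a : m ⟶ m') (a' : m' ⟶ m) (b : l ⟶ l')
    (b' : l' ⟶ l) (γ₁ : m' ⊗ s ⟶ y ⊗ m') (γ₂ : l' ⊗ x ⟶ s ⊗ l') :
    tubeComp (a ▷ s ≫ γ₁ ≫ y ◁ a') (b ▷ x ≫ γ₂ ≫ s ◁ b') =
      (a ⊗ₘ b) ▷ x ≫ tubeComp γ₁ γ₂ ≫ y ◁ (a' ⊗ₘ b') := by
  calc
    _ = 𝟙 _ ⊗≫ m ◁ b ▷ x ⊗≫ m ◁ γ₂ ⊗≫ (m ◁ (s ◁ b') ⊗≫ (a ▷ s) ▷ l) ⊗≫ γ₁ ▷ l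
          ⊗≫ y ◁ a' ▷ l ⊗≫ 𝟙 _ := by
      dsimp only [tubeComp]; monoidal
    _ = 𝟙 _ ⊗≫ m ◁ b ▷ x ⊗≫ m ◁ γ₂ ⊗≫ ((m ⊗ s) ◁ b' ≫ (a ▷ s) ▷ l) ⊗≫ γ₁ ▷ l
          ⊗≫ y ◁ a' ▷ l ⊗≫ 𝟙 _ := by
      monoidal
    _ = 𝟙 _ ⊗≫ m ◁ b ▷ x ⊗≫ (m ◁ γ₂ ≫ a ▷ (s ⊗ l')) ⊗≫ ((m' ⊗ s) ◁ b' ≫ γ₁ ▷ l)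
          ⊗≫ y ◁ a' ▷ l ⊗≫ 𝟙 _ := by
      rw [whisker_exchange]; monoidal
    _ = 𝟙 _ ⊗≫ (m ◁ (b ▷ x) ≫ a ▷ (l' ⊗ x)) ⊗≫ m' ◁ γ₂ ⊗≫ γ₁ ▷ l' ⊗≫ ((y ⊗ m') ◁ b'
          ≫ (y ◁ a') ▷ l) ⊗≫ 𝟙 _ := by
      rw [whisker_exchange, whisker_exchange]; monoidal
    _ = 𝟙 _ ⊗≫ (m ◁ (b ▷ x) ≫ a ▷ (l' ⊗ x)) ⊗≫ m' ◁ γ₂ ⊗≫ γ₁ ▷ l' ⊗≫ y ◁ (m' ◁ b'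
          ≫ a' ▷ l) ⊗≫ 𝟙 _ := by
      monoidal
    _ = _ := by
      rw [whisker_exchange, whisker_exchange]
      simp only [MonoidalCategory.tensorHom_def]
      dsimp only [tubeComp]; monoidal

theorem tubeComp_assoc {x s t y m l n : C} (γ₁ : m ⊗ t ⟶ y ⊗ m) (γ₂ : l ⊗ s ⟶ t ⊗ l)
    (γ₃ : n ⊗ x ⟶ s ⊗ n) :
    tubeComp (tubeComp γ₁ γ₂) γ₃ =
      (α_ m l n).hom ▷ x ≫ tubeComp γ₁ (tubeComp γ₂ γ₃) ≫ y ◁ (α_ m l n).inv := by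
  dsimp only [tubeComp]; monoidal

variable (z z' : C) [ExactPairing z z']

/-- The rotation of `g : y ⊗ z ⟶ z ⊗ x` by the duality of `z` and `z'`: the strands of `z` are bent
to the other sides, giving `(ε ⊗ 1 ⊗ 1) (1 ⊗ g ⊗ 1) (1 ⊗ 1 ⊗ η)`. -/
def turn {x y : C} (g : y ⊗ z ⟶ z ⊗ x) : z' ⊗ y ⟶ x ⊗ z' :=
  z' ◁ ((ρ_ y).inv ≫ y ◁ η_ z z' ≫ (α_ y z z').inv ≫ g ▷ z' ≫ (α_ z x z').hom) ≫
    (α_ z' z (x ⊗ z')).inv ≫ ε_ z z' ▷ (x ⊗ z') ≫ (λ_ (x ⊗ z')).hom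

/-- The dual `z' ⟶ w'` of a morphism `w ⟶ z`. -/
def dualMap {w : C} (w' : C) [ExactPairing w w'] (a : w ⟶ z) : z' ⟶ w' :=
  @rightAdjointMate C _ _ w z ⟨w'⟩ ⟨z'⟩ a

variable {z z'}

theorem coev_turn {x y : C} (g : y ⊗ z ⟶ z ⊗ x) :
    η_ z z' ▷ y ⊗≫ z ◁ turn z z' g = 𝟙 _ ⊗≫ y ◁ η_ z z' ⊗≫ g ▷ z' ⊗≫ 𝟙 _ := by
  have h := (tensorLeftHomEquiv y z z' (x ⊗ z')).apply_symm_apply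
    ((ρ_ y).inv ≫ y ◁ η_ z z' ≫ (α_ y z z').inv ≫ g ▷ z' ≫ (α_ z x z').hom)
  have h2 : (λ_ y).inv ≫ η_ z z' ▷ y ≫ (α_ z z' y).hom ≫ z ◁ turn z z' g =
    (ρ_ y).inv ≫ y ◁ η_ z z' ≫ (α_ y z z').inv ≫ g ▷ z' ≫ (α_ z x z').hom := h
  calc
    _ = (λ_ y).hom ≫ ((λ_ y).inv ≫ η_ z z' ▷ y ≫ (α_ z z' y).hom ≫ z ◁ turn z z' g) := by
      monoidal
    _ = _ := by
      rw [h2]; monoidal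

/-- A rotated morphism is determined by sliding it along the coevaluation. -/
theorem turn_unique {x y : C} (g : y ⊗ z ⟶ z ⊗ x) (f : z' ⊗ y ⟶ x ⊗ z')
    (h : η_ z z' ▷ y ⊗≫ z ◁ f = 𝟙 _ ⊗≫ y ◁ η_ z z' ⊗≫ g ▷ z' ⊗≫ 𝟙 _) :
    turn z z' g = f := by
  apply (tensorLeftHomEquiv y z z' (x ⊗ z')).injective
  change (λ_ y).inv ≫ η_ z z' ▷ y ≫ (α_ z z' y).hom ≫ z ◁ turn z z' g =
    (λ_ y).inv ≫ η_ z z' ▷ y ≫ (α_ z z' y).hom ≫ z ◁ f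
  have := (coev_turn (z' := z') g).trans h.symm
  calc
    _ = (λ_ y).inv ≫ (η_ z z' ▷ y ⊗≫ z ◁ turn z z' g) := by monoidal
    _ = _ := by
      rw [this]; monoidal

/-- A rotated morphism can be slid along the evaluation. -/
theorem turn_ev {x y : C} (g : y ⊗ z ⟶ z ⊗ x) :
    turn z z' g ▷ z ⊗≫ x ◁ ε_ z z' = 𝟙 _ ⊗≫ z' ◁ g ⊗≫ ε_ z z' ▷ x ⊗≫ 𝟙 _ := by
  calc
    _ = 𝟙 _ ⊗≫ z' ◁ y ◁ η_ z z' ▷ z ⊗≫ z' ◁ g ▷ z' ▷ z ⊗≫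
        (ε_ z z' ▷ (x ⊗ (z' ⊗ z)) ≫ 𝟙_ C ◁ (x ◁ ε_ z z')) ⊗≫ 𝟙 _ := by
      dsimp only [turn]; monoidal
    _ = 𝟙 _ ⊗≫ z' ◁ y ◁ η_ z z' ▷ z ⊗≫ z' ◁ (g ▷ (z' ⊗ z) ≫ (z ⊗ x) ◁ ε_ z z') ⊗≫
        ε_ z z' ▷ x ⊗≫ 𝟙 _ := by
      rw [← whisker_exchange]; monoidal
    _ = 𝟙 _ ⊗≫ z' ◁ y ◁ (η_ z z' ▷ z ⊗≫ z ◁ ε_ z z') ⊗≫ z' ◁ g ⊗≫ ε_ z z' ▷ x ⊗≫ 𝟙 _ := by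
      rw [← whisker_exchange]; monoidal
    _ = _ := by
      rw [evaluation_coevaluation'']; monoidal

/-- The rotation of a composed tube by the duality of `m ⊗ l` and `l' ⊗ m'` is the composition of the
rotated tubes in the opposite order. -/
theorem turn_tubeComp {x s y m l m' l' : C} [ExactPairing m m'] [ExactPairing l l']
    (g₁ : y ⊗ m ⟶ m ⊗ s) (g₂ : s ⊗ l ⟶ l ⊗ x) :
    turn (m ⊗ l) (l' ⊗ m')
      ((α_ y m l).inv ≫ g₁ ▷ l ≫ (α_ m s l).hom ≫ m ◁ g₂ ≫ (α_ m l x).inv) =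
      tubeComp (turn l l' g₂) (turn m m' g₁) := by
  apply turn_unique
  rw [tensor_coevaluation]
  calc
    _ = η_ m m' ▷ y ⊗≫ m ◁ (η_ l l' ▷ (m' ⊗ y) ≫ (l ⊗ l') ◁ turn m m' g₁) ⊗≫
        m ◁ l ◁ turn l l' g₂ ▷ m' ⊗≫ 𝟙 _ := by
      dsimp only [tubeComp]; monoidal
    _ = (η_ m m' ▷ y ⊗≫ m ◁ turn m m' g₁) ⊗≫
        m ◁ (η_ l l' ▷ s ⊗≫ l ◁ turn l l' g₂) ▷ m' ⊗≫ 𝟙 _ := by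
      rw [← whisker_exchange]; monoidal
    _ = 𝟙 _ ⊗≫ y ◁ η_ m m' ⊗≫ (g₁ ▷ (𝟙_ C ⊗ m') ≫ (m ⊗ s) ◁ (η_ l l' ▷ m')) ⊗≫
        m ◁ g₂ ▷ l' ▷ m' ⊗≫ 𝟙 _ := by
      rw [coev_turn, coev_turn]; monoidal
    _ = _ := by
      rw [← whisker_exchange]; monoidal

theorem coev_dualMap {w w' : C} [ExactPairing w w'] (a : w ⟶ z) :
    η_ z z' ≫ z ◁ dualMap z z' w' a = η_ w w' ≫ a ▷ w' := by
  let : HasRightDual w := ⟨w'⟩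
  let : HasRightDual z := ⟨z'⟩
  exact coevaluation_comp_rightAdjointMate a

theorem dualMap_comp {w w' : C} [ExactPairing w w'] {t t' : C} [ExactPairing t t']
    (a : t ⟶ w) (b : w ⟶ z) :
    dualMap z z' w' b ≫ dualMap w w' t' a = dualMap z z' t' (a ≫ b) := by
  let : HasRightDual w := ⟨w'⟩
  let : HasRightDual z := ⟨z'⟩
  let : HasRightDual t := ⟨t'⟩
  exact (comp_rightAdjointMate (f := a) (g := b)).symm

theorem dualMap_id : dualMap z z' z' (𝟙 z) = 𝟙 z' := by
  let : HasRightDual z := ⟨z'⟩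
  exact rightAdjointMate_id

theorem turn_conj {x y w w' : C} [ExactPairing w w'] (a : w ⟶ z) (b : z ⟶ w)
    (g : y ⊗ z ⟶ z ⊗ x) :
    turn w w' (y ◁ a ≫ g ≫ b ▷ x) =
      dualMap w w' z' b ▷ y ≫ turn z z' g ≫ x ◁ dualMap z z' w' a := by
  apply turn_unique
  calc
    _ = (η_ w w' ≫ w ◁ dualMap w w' z' b) ▷ y ⊗≫ w ◁ turn z z' g ⊗≫
        w ◁ x ◁ dualMap z z' w' a := by
      monoidal
    _ = η_ z z' ▷ y ⊗≫ (b ▷ (z' ⊗ y) ≫ w ◁ turn z z' g) ⊗≫ w ◁ x ◁ dualMap z z' w' a := by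
      rw [coev_dualMap]; monoidal
    _ = (η_ z z' ▷ y ⊗≫ z ◁ turn z z' g) ⊗≫ b ▷ (x ⊗ z') ⊗≫ w ◁ x ◁ dualMap z z' w' a := by
      rw [← whisker_exchange]; monoidal
    _ = 𝟙 _ ⊗≫ y ◁ η_ z z' ⊗≫ ((g ≫ b ▷ x) ▷ z' ≫ (w ⊗ x) ◁ dualMap z z' w' a) ⊗≫ 𝟙 _ := by
      rw [coev_turn]; monoidal
    _ = 𝟙 _ ⊗≫ y ◁ (η_ z z' ≫ z ◁ dualMap z z' w' a) ⊗≫ (g ≫ b ▷ x) ▷ w' ⊗≫ 𝟙 _ := by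
      rw [← whisker_exchange]; monoidal
    _ = _ := by
      rw [coev_dualMap]; monoidal

theorem turn_id : turn z z' ((λ_ z).hom ≫ (ρ_ z).inv) = (ρ_ z').hom ≫ (λ_ z').inv := by
  apply turn_unique
  monoidal

theorem turn_coev {x : C} (f : z' ⊗ z ⟶ x) :
    turn z z' (η_ z z' ▷ z ≫ (α_ z z' z).hom ≫ z ◁ f) =
      z' ◁ η_ z z' ≫ (α_ z' z z').inv ≫ f ▷ z' := by
  apply turn_unique
  calc
    _ = 𝟙 _ ⊗≫ (η_ z z' ▷ 𝟙_ C ≫ (z ⊗ z') ◁ η_ z z') ⊗≫ z ◁ f ▷ z' := by monoidal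
    _ = _ := by
      rw [← whisker_exchange]; monoidal

end Duality

/-! ### Adjoints and solutions of the conjugate equations -/

section

variable {C : Type u} [Category.{v} C] [Preadditive C] [Linear ℂ C]
  [MonoidalCategory C] [MonoidalPreadditive C] [MonoidalLinear ℂ C] [CStarTensorCategory C]

open CStarCategory CStarTensorCategory

theorem adj_associator_inv (X Y Z : C) : adj (α_ X Y Z).inv = (α_ X Y Z).hom := by
  rw [← adj_associator, adj_adj]

theorem adj_leftUnitor_inv (X : C) : adj (λ_ X).inv = (λ_ X).hom := by
  rw [← adj_leftUnitor, adj_adj]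

theorem adj_id (X : C) : adj (𝟙 X) = 𝟙 X := by
  have h := adj_comp (𝟙 X) (adj (𝟙 X))
  rw [adj_adj, Category.id_comp, adj_adj] at h
  exact h.symm

namespace ConjugateSolution

variable {X Y : C} (r : ConjugateSolution X Y)

/-- A solution of the conjugate equations is a duality, with `Rbar` as coevaluation and `R*` as
evaluation. -/
@[reducible]
def exactPairing : ExactPairing X Y where
  coevaluation' := r.Rbar
  evaluation' := adj r.R
  coevaluation_evaluation' := by
    have h := congrArg adj r.conj_left
    simp only [adj_comp, adj_id, adj_leftUnitor_inv, adj_rightUnitor, adj_whiskerLeft,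
      adj_whiskerRight, adj_associator, adj_adj, Category.assoc] at h
    calc
      _ = (ρ_ Y).hom ≫ ((ρ_ Y).inv ≫ Y ◁ r.Rbar ≫ (α_ Y X Y).inv ≫ adj r.R ▷ Y ≫ (λ_ Y).hom) ≫
          (λ_ Y).inv := by simp
      _ = _ := by rw [h, Category.id_comp]
  evaluation_coevaluation' := by
    calc
      _ = (λ_ X).hom ≫ ((λ_ X).inv ≫ r.Rbar ▷ X ≫ (α_ X Y X).hom ≫ X ◁ adj r.R ≫ (ρ_ X).hom) ≫
          (ρ_ X).inv := by simp
      _ = _ := by rw [r.conj_right, Category.id_comp]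

/-- The solution of the conjugate equations with the roles of the two objects exchanged. -/
def swap : ConjugateSolution Y X where
  R := r.Rbar
  Rbar := r.R
  conj_left := r.conj_right
  conj_right := r.conj_left

/-- Rotating an adjoint twice, by a solution and by the swapped solution, gives back the morphism: the
adjoint of the evaluation relation of the first rotation is the coevaluation relation of the
second. -/
theorem turn_turn {x y : C} (γ : X ⊗ x ⟶ y ⊗ X) :
    let := r.exactPairing
    let := r.swap.exactPairing
    turn Y X (adj (turn X Y (adj γ))) = γ := by
  let := r.exactPairing
  let := r.swap.exactPairing
  apply turn_unique
  have h : turn X Y (adj γ) ▷ X ≫ (α_ x Y X).hom ≫ x ◁ adj r.R ≫ (ρ_ x).hom =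
      (α_ Y y X).hom ≫ Y ◁ adj γ ≫ (α_ Y X x).inv ≫ adj r.R ▷ x ≫ (λ_ x).hom := by
    have := turn_ev (z := X) (z' := Y) (adj γ)
    calc
      _ = (turn X Y (adj γ) ▷ X ⊗≫ x ◁ ExactPairing.evaluation X Y) ≫ (ρ_ x).hom := by
        change turn X Y (adj γ) ▷ X ≫ (α_ x Y X).hom ≫ x ◁ ExactPairing.evaluation X Y ≫
          (ρ_ x).hom = _
        monoidal
      _ = _ := by
        rw [this]
        change _ = (α_ Y y X).hom ≫ Y ◁ adj γ ≫ (α_ Y X x).inv ≫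
          ExactPairing.evaluation X Y ▷ x ≫ (λ_ x).hom
        monoidal
  have h' := congrArg adj h
  simp only [adj_comp, adj_leftUnitor, adj_rightUnitor, adj_whiskerLeft, adj_associator_inv,
    adj_whiskerRight, adj_associator, adj_adj, Category.assoc] at h'
  change r.R ▷ x ⊗≫ Y ◁ γ = 𝟙 _ ⊗≫ x ◁ r.R ⊗≫ adj (turn X Y (adj γ)) ▷ X ⊗≫ 𝟙 _
  calc
    _ = (λ_ x).hom ≫ ((λ_ x).inv ≫ r.R ▷ x ≫ (α_ Y X x).hom ≫ Y ◁ γ ≫ (α_ Y y X).inv) ≫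
        (α_ Y y X).hom := by
      monoidal
    _ = _ := by
      rw [← h']; monoidal

/-- The rotation of an endomorphism of `Y ⊗ X` by a quarter turn, to an endomorphism of `X ⊗ Y`. -/
noncomputable def quarterTurn :
    (Y ⊗ X ⟶ Y ⊗ X) →ₗ[ℂ] ((X ⊗ Y) ⊗ 𝟙_ C ⟶ 𝟙_ C ⊗ (X ⊗ Y)) where
  toFun p := (α_ X Y (𝟙_ C)).hom ≫
    X ◁ (Y ◁ r.Rbar ≫ (α_ Y X Y).inv ≫ p ▷ Y ≫ (α_ Y X Y).hom) ≫
    (α_ X Y (X ⊗ Y)).inv ≫ adj r.Rbar ▷ (X ⊗ Y)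
  map_add' _ _ := by simp
  map_smul' _ _ := by simp

theorem quarterTurn_id :
    r.quarterTurn (𝟙 (Y ⊗ X)) = adj r.Rbar ▷ 𝟙_ C ≫ 𝟙_ C ◁ r.Rbar := by
  change (α_ X Y (𝟙_ C)).hom ≫
    X ◁ (Y ◁ r.Rbar ≫ (α_ Y X Y).inv ≫ 𝟙 (Y ⊗ X) ▷ Y ≫ (α_ Y X Y).hom) ≫
    (α_ X Y (X ⊗ Y)).inv ≫ adj r.Rbar ▷ (X ⊗ Y) = _
  rw [← whisker_exchange]
  monoidal

end ConjugateSolution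

theorem adj_tubeComp {x s y m l : C} (γ₁ : m ⊗ s ⟶ y ⊗ m) (γ₂ : l ⊗ x ⟶ s ⊗ l) :
    adj (tubeComp γ₁ γ₂) =
      (α_ y m l).inv ≫ adj γ₁ ▷ l ≫ (α_ m s l).hom ≫ m ◁ adj γ₂ ≫ (α_ m l x).inv := by
  simp only [tubeComp, adj_comp, adj_whiskerLeft, adj_associator_inv, adj_whiskerRight,
    adj_associator, Category.assoc]

end

/-! ### Finite-dimensional algebras with involution -/

section

variable {A : Type*} [Ring A] [StarRing A]

/-- An idempotent that commutes with its adjoint is self-adjoint, if the involution is proper. -/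
theorem star_eq_self_of_idempotent (hproper : ∀ x : A, star x * x = 0 → x = 0) {e : A}
    (he : e * e = e) (hcomm : star e * e = e * star e) : star e = e := by
  have hs : star e * star e = star e := by rw [← star_mul, he]
  have hx : star (e - e * star e) * (e - e * star e) = 0 := by
    have h1 : star (e - e * star e) = star e - e * star e := by simp
    have h2 : star e * (e * star e) = e * star e := by rw [← mul_assoc, hcomm, mul_assoc, hs]
    have h3 : e * star e * e = e * star e := by rw [mul_assoc, hcomm, ← mul_assoc, he]
    have h4 : e * star e * (e * star e) = e * star e := by rw [← mul_assoc, h3, mul_assoc, hs]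
    rw [h1, sub_mul, mul_sub, mul_sub, h2, h3, h4, hcomm]
    simp
  have h := sub_eq_zero.1 (hproper _ hx)
  rw [h]
  simp

variable [Algebra ℂ A]

/-- In a finite-dimensional algebra with proper involution and without nontrivial projections, every
self-adjoint element `h` is a scalar: otherwise a root `t` of its minimal polynomial yields, up to
normalization, the projection `q(h)` with `q = minpoly / (X - t)`. -/
theorem exists_eq_algebraMap_of_isSelfAdjoint [FiniteDimensional ℂ A] [Nontrivial A]
    (hproper : ∀ x : A, star x * x = 0 → x = 0)
    (hproj : ∀ p : A, p * p = p → star p = p → p = 0 ∨ p = 1)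
    (hsmul : ∀ (c : ℂ) (x : A), star (c • x) = star c • star x)
    {h : A} (hh : star h = h) : ∃ c : ℂ, h = algebraMap ℂ A c := by
  classical
  have hint : IsIntegral ℂ h := IsIntegral.of_finite ℂ h
  obtain ⟨t, ht⟩ := IsAlgClosed.exists_root (minpoly ℂ h) (minpoly.degree_pos hint).ne'
  obtain ⟨q, hq⟩ := Polynomial.dvd_iff_isRoot.2 ht
  have hq0 : q ≠ 0 := by
    rintro rfl
    exact minpoly.ne_zero hint (by simpa using hq)
  set e : A := Polynomial.aeval h q with he
  have he0 : e ≠ 0 := by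
    intro h0
    have hdvd : minpoly ℂ h ∣ q := minpoly.dvd ℂ h h0
    have hdeg := Polynomial.natDegree_le_of_dvd hdvd hq0
    rw [hq, Polynomial.natDegree_mul (Polynomial.X_sub_C_ne_zero t) hq0,
      Polynomial.natDegree_X_sub_C] at hdeg
    omega
  have key : ∀ p : Polynomial ℂ, Polynomial.aeval h p * e = p.eval t • e := by
    intro p
    obtain ⟨r, hr⟩ := Polynomial.X_sub_C_dvd_sub_C_eval (a := t) (p := p)
    have h1 : Polynomial.aeval h ((p - Polynomial.C (p.eval t)) * q) = 0 := by
      have h2 : (p - Polynomial.C (p.eval t)) * q = minpoly ℂ h * r := by rw [hr, hq]; ring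
      rw [h2, map_mul, minpoly.aeval, zero_mul]
    rw [map_mul, map_sub, Polynomial.aeval_C, sub_mul, sub_eq_zero] at h1
    rw [h1, Algebra.smul_def]
  have hhe : h * e = t • e := by simpa using key Polynomial.X
  have hcomm_h : ∀ x : A, x * h = h * x → x * e = e * x := by
    intro x hx
    have h1 : e ∈ Algebra.adjoin ℂ {h} := Polynomial.aeval_mem_adjoin_singleton ℂ h
    have h2 : Algebra.adjoin ℂ {h} ≤ Subalgebra.centralizer ℂ {x} := by
      apply Algebra.adjoin_le
      rintro _ rfl
      rw [SetLike.mem_coe, Subalgebra.mem_centralizer_iff]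
      rintro _ rfl
      exact hx
    exact (Subalgebra.mem_centralizer_iff ℂ).1 (h2 h1) x rfl
  have hcomm : star e * e = e * star e := by
    apply hcomm_h
    have h1 := hcomm_h h rfl
    have h2 := congrArg star h1
    rwa [star_mul, star_mul, hh] at h2
  have hee : e * e = q.eval t • e := key q
  by_cases hc : q.eval t = 0
  · exfalso
    rw [hc, zero_smul] at hee
    apply he0
    apply hproper
    apply hproper
    rw [star_mul, star_star, hcomm, ← mul_assoc, mul_assoc e, hcomm, ← mul_assoc, hee]
    simp
  · set f : A := (q.eval t)⁻¹ • e with hf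
    have hff : f * f = f := by
      rw [hf, smul_mul_smul_comm, hee, smul_smul]
      congr 1
      field_simp
    have hfs : star f * f = f * star f := by
      rw [hf, hsmul, smul_mul_smul_comm, smul_mul_smul_comm, hcomm, mul_comm]
    rcases hproj f hff (star_eq_self_of_idempotent hproper hff hfs) with h0 | h1
    · exact absurd ((smul_eq_zero.1 h0).resolve_left (inv_ne_zero hc)) he0
    · have h2 : e = q.eval t • (1 : A) := by
        rw [← h1, hf, smul_smul, mul_inv_cancel₀ hc, one_smul]
      rw [h2, mul_smul_comm, mul_one, smul_comm] at hhe
      refine ⟨t, ?_⟩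
      rw [Algebra.algebraMap_eq_smul_one]
      exact smul_right_injective A hc hhe

theorem exists_eq_algebraMap_of_projections_trivial [FiniteDimensional ℂ A] [Nontrivial A]
    (hproper : ∀ x : A, star x * x = 0 → x = 0)
    (hproj : ∀ p : A, p * p = p → star p = p → p = 0 ∨ p = 1)
    (hsmul : ∀ (c : ℂ) (x : A), star (c • x) = star c • star x)
    (f : A) : ∃ c : ℂ, f = algebraMap ℂ A c := by
  obtain ⟨a, ha⟩ := exists_eq_algebraMap_of_isSelfAdjoint hproper hproj hsmul
    (h := f + star f) (by simp [add_comm])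
  obtain ⟨b, hb⟩ := exists_eq_algebraMap_of_isSelfAdjoint hproper hproj hsmul
    (h := Complex.I • (f - star f)) (by
      have h1 : star Complex.I = -Complex.I := Complex.conj_I
      rw [hsmul, star_sub, star_star, h1, neg_smul, ← smul_neg, neg_sub])
  refine ⟨(a - Complex.I * b) / 2, ?_⟩
  rw [Algebra.algebraMap_eq_smul_one] at ha hb ⊢
  have h1 : (2 : ℂ) • f = (f + star f) - Complex.I • (Complex.I • (f - star f)) := by
    rw [smul_smul, Complex.I_mul_I, two_smul, neg_one_smul]
    abel
  have h2 : (2 : ℂ) • f = (2 : ℂ) • (((a - Complex.I * b) / 2) • (1 : A)) := by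
    rw [h1, ha, hb, smul_smul, smul_smul, ← sub_smul]
    congr 1
    ring
  exact smul_right_injective A (two_ne_zero (α := ℂ)) h2

end

section

variable {C : Type u} [Category.{v} C] [Preadditive C] [Linear ℂ C]

/-! ### Simple objects of a C*-category -/

section CStar

variable [CStarCategory C]

open CStarCategory

theorem adj_zero {X Y : C} : adj (0 : X ⟶ Y) = 0 := by
  simpa using adj_smul (0 : ℂ) (0 : X ⟶ Y)

theorem adj_neg {X Y : C} (f : X ⟶ Y) : adj (-f) = -adj f := by
  simpa using adj_smul (-1 : ℂ) f

theorem adj_sub {X Y : C} (f g : X ⟶ Y) : adj (f - g) = adj f - adj g := by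
  rw [sub_eq_add_neg, adj_add, adj_neg, sub_eq_add_neg]

theorem adj_sum {X Y : C} {ι : Type*} (s : Finset ι) (f : ι → (X ⟶ Y)) :
    adj (∑ i ∈ s, f i) = ∑ i ∈ s, adj (f i) :=
  map_sum (AddMonoidHom.mk' (adj : (X ⟶ Y) → (Y ⟶ X)) adj_add) f s

theorem homNorm_zero {X Y : C} : homNorm (0 : X ⟶ Y) = 0 := by
  simpa using homNorm_smul (0 : ℂ) (0 : X ⟶ Y)

theorem homNorm_nonneg {X Y : C} (f : X ⟶ Y) : 0 ≤ homNorm f := by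
  have h := homNorm_add_le f ((-1 : ℂ) • f)
  rw [homNorm_smul] at h
  have h2 : f + (-1 : ℂ) • f = 0 := by simp
  rw [h2, homNorm_zero] at h
  simp only [norm_neg, norm_one, one_mul] at h
  linarith

theorem eq_zero_of_comp_adj {X Y : C} {f : X ⟶ Y} (h : f ≫ adj f = 0) : f = 0 := by
  apply eq_zero_of_homNorm_eq_zero
  have h1 := homNorm_adj_mul_self f
  rw [h, homNorm_zero] at h1
  exact pow_eq_zero_iff two_ne_zero |>.1 h1.symm

theorem homNorm_projection {X : C} {p : X ⟶ X} (hp : p ≫ p = p) (hs : adj p = p) (h0 : p ≠ 0) :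
    homNorm p = 1 := by
  have h1 := homNorm_adj_mul_self p
  rw [hs, hp] at h1
  have h2 : homNorm p ≠ 0 := fun h => h0 (eq_zero_of_homNorm_eq_zero p h)
  have h3 : homNorm p * (homNorm p - 1) = 0 := by nlinarith
  linarith [(mul_eq_zero.1 h3).resolve_left h2]

omit [CStarCategory C] in
theorem IsSimple.id_ne_zero {k : C} (hk : IsSimple k) : 𝟙 k ≠ 0 := by
  intro h
  obtain ⟨c, -, hc⟩ := hk 0
  have h0 := hc 0 (by simp)
  have h1 := hc 1 (by simp [h])
  exact one_ne_zero (h1.trans h0.symm)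

omit [CStarCategory C] in
theorem IsSimple.smul_id_injective {k : C} (hk : IsSimple k) {a b : ℂ}
    (h : a • 𝟙 k = b • 𝟙 k) : a = b :=
  (hk (a • 𝟙 k)).unique rfl h

omit [CStarCategory C] in
theorem IsSimple.exists_smul {k : C} (hk : IsSimple k) (f : k ⟶ k) : ∃ c : ℂ, f = c • 𝟙 k :=
  (hk f).exists

/-- The form `σ* σ` is nonnegative on morphisms out of a simple object. -/
theorem IsSimple.exists_nonneg {k z : C} (hk : IsSimple k) (f : k ⟶ z) :
    ∃ c : ℝ, 0 ≤ c ∧ f ≫ adj f = (c : ℂ) • 𝟙 k := by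
  obtain ⟨g, hg⟩ := adj_mul_self_pos f
  obtain ⟨d, rfl⟩ := hk.exists_smul g
  have hid : adj (𝟙 k) = 𝟙 k := by
    have h := adj_comp (𝟙 k) (adj (𝟙 k))
    rw [adj_adj, Category.id_comp, adj_adj] at h
    exact h.symm
  refine ⟨Complex.normSq d, Complex.normSq_nonneg d, ?_⟩
  rw [hg, adj_smul, hid, Linear.smul_comp, Linear.comp_smul, smul_smul, Category.comp_id,
    Complex.normSq_eq_conj_mul_self, mul_comm]
  rfl

theorem IsSimple.exists_pos {k z : C} (hk : IsSimple k) {f : k ⟶ z} (hf : f ≠ 0) :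
    ∃ c : ℝ, 0 < c ∧ f ≫ adj f = (c : ℂ) • 𝟙 k := by
  obtain ⟨c, hc, h⟩ := hk.exists_nonneg f
  refine ⟨c, lt_of_le_of_ne hc ?_, h⟩
  rintro rfl
  exact hf (eq_zero_of_comp_adj (by simpa using h))

theorem IsSimple.nonempty_iso {k l : C} (hk : IsSimple k) (hl : IsSimple l) {f : k ⟶ l}
    (hf : f ≠ 0) : Nonempty (k ≅ l) := by
  obtain ⟨c, hc, h1⟩ := hk.exists_pos hf
  obtain ⟨d, h2⟩ := hl.exists_smul (adj f ≫ f)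
  have h3 : (c : ℂ) • f = d • f := by
    have h4 : (f ≫ adj f) ≫ f = f ≫ adj f ≫ f := Category.assoc _ _ _
    rw [h1, h2, Linear.smul_comp, Linear.comp_smul, Category.id_comp, Category.comp_id] at h4
    exact h4
  have h5 : (c : ℂ) = d := by
    by_contra hne
    rw [← sub_eq_zero, ← sub_smul] at h3
    exact hf ((smul_eq_zero.1 h3).resolve_left (sub_ne_zero.2 hne))
  have hc' : (c : ℂ) ≠ 0 := by exact_mod_cast hc.ne'
  refine ⟨⟨f, (c : ℂ)⁻¹ • adj f, ?_, ?_⟩⟩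
  · rw [Linear.comp_smul, h1, smul_smul, inv_mul_cancel₀ hc', one_smul]
  · rw [Linear.smul_comp, h2, ← h5, smul_smul, inv_mul_cancel₀ hc', one_smul]

end CStar

end

section

variable {C : Type u} [Category.{v} C] [Preadditive C] [Linear ℂ C]
  [MonoidalCategory C] [MonoidalPreadditive C] [MonoidalLinear ℂ C] [CStarTensorCategory C]

open CStarCategory CStarTensorCategory

omit [MonoidalPreadditive C] [MonoidalLinear ℂ C] [CStarTensorCategory C] in
theorem Irr.eq_of_iso (h1 : IsSimple (𝟙_ C)) {k l : Irr C} (e : k.obj ≅ l.obj) : k = l :=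
  (Irr.existsUnique k.obj (k.isSimple_obj h1)).unique ⟨Iso.refl _⟩ ⟨e⟩

theorem Irr.hom_eq_zero (h1 : IsSimple (𝟙_ C)) {k l : Irr C} (hkl : k ≠ l) (f : k.obj ⟶ l.obj) :
    f = 0 := by
  by_contra hf
  obtain ⟨e⟩ := (k.isSimple_obj h1).nonempty_iso (l.isSimple_obj h1) hf
  exact hkl (Irr.eq_of_iso h1 e)

/-! ### Finiteness from rigidity -/

/-- A morphism `f` out of `X` is recovered from `(1 ⊗ f) R`. -/
theorem ConjugateSolution.eq_of_R_comp {X Y Z : C} (r : ConjugateSolution X Y) (f : X ⟶ Z) :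
    (ρ_ X).inv ≫ X ◁ (r.R ≫ Y ◁ f) ≫ (α_ X Y Z).inv ≫ adj r.Rbar ▷ Z ≫ (λ_ Z).hom = f := by
  have h := congrArg adj r.conj_right
  simp only [adj_comp, adj_id, adj_leftUnitor_inv, adj_rightUnitor, adj_whiskerLeft,
    adj_whiskerRight, adj_associator, adj_adj, Category.assoc] at h
  calc
    _ = 𝟙 _ ⊗≫ X ◁ r.R ⊗≫ ((X ⊗ Y) ◁ f ≫ adj r.Rbar ▷ Z) ⊗≫ 𝟙 _ := by monoidal
    _ = ((ρ_ X).inv ≫ X ◁ r.R ≫ (α_ X Y X).inv ≫ adj r.Rbar ▷ X ≫ (λ_ X).hom) ≫ f := by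
      rw [whisker_exchange]; monoidal
    _ = f := by rw [h, Category.id_comp]

theorem ConjugateSolution.R_comp_injective {X Y Z : C} (r : ConjugateSolution X Y)
    {f g : X ⟶ Z} (h : r.R ≫ Y ◁ f = r.R ≫ Y ◁ g) : f = g := by
  rw [← r.eq_of_R_comp f, h, r.eq_of_R_comp]

/-- In a rigid category with simple unit, the size of families of mutually orthogonal projections on
an object is bounded. For a conjugate solution `(R, Rbar)` the values `R* (1 ⊗ p) R` of such
projections sum to at most `R* R`, and each of them is bounded below since `p` can be recovered from
`(1 ⊗ p) R`. -/
theorem exists_card_projections_le (rigid : IsRigid C) (h1 : IsSimple (𝟙_ C)) (z : C) :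
    ∃ N : ℕ, ∀ s : Finset (z ⟶ z), (∀ p ∈ s, p ≫ p = p ∧ adj p = p ∧ p ≠ 0) →
      (∀ p ∈ s, ∀ q ∈ s, p ≠ q → p ≫ q = 0) → s.card ≤ N := by
  classical
  obtain ⟨z', ⟨r⟩⟩ := rigid z
  have hval : ∀ p : z ⟶ z, ∃ c : ℝ, 0 ≤ c ∧ (p ≫ p = p → adj p = p →
      r.R ≫ z' ◁ p ≫ adj r.R = (c : ℂ) • 𝟙 (𝟙_ C)) ∧
      (r.R ≫ z' ◁ p) ≫ adj (r.R ≫ z' ◁ p) = (c : ℂ) • 𝟙 (𝟙_ C) := by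
    intro p
    obtain ⟨c, hc, h⟩ := h1.exists_nonneg (r.R ≫ z' ◁ p)
    refine ⟨c, hc, fun hp hs => ?_, h⟩
    rw [← h, adj_comp, adj_whiskerLeft, hs, Category.assoc, ← whiskerLeft_comp_assoc, hp]
  choose c hc0 hc hcn using hval
  set K : ℝ := homNorm ((α_ z z' z).inv ≫ adj r.Rbar ▷ z ≫ (λ_ z).hom)
  set L : ℝ := homNorm (ρ_ z).inv
  set M : ℝ := homNorm (𝟙 (z ⊗ 𝟙_ C))
  have hK : 0 ≤ K := homNorm_nonneg _
  have hL : 0 ≤ L := homNorm_nonneg _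
  have hbound : ∀ p : z ⟶ z, p ≫ p = p → adj p = p → p ≠ 0 → 1 ≤ (L * K) ^ 2 * M * c p := by
    intro p hp hs h0
    have e1 : homNorm (z ◁ (r.R ≫ z' ◁ p)) ^ 2 = c p * M := by
      rw [← homNorm_adj_mul_self, adj_whiskerLeft, ← whiskerLeft_comp, hcn p]
      rw [MonoidalLinear.whiskerLeft_smul, homNorm_smul, whiskerLeft_id, Complex.norm_real,
        Real.norm_of_nonneg (hc0 p)]
    have e2 : (1 : ℝ) ≤ L * (homNorm (z ◁ (r.R ≫ z' ◁ p)) * K) := by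
      rw [← homNorm_projection hp hs h0]
      nth_rw 1 [← r.eq_of_R_comp p]
      refine (homNorm_comp_le _ _).trans (mul_le_mul_of_nonneg_left ?_ hL)
      exact homNorm_comp_le _ _
    have e3 : (1 : ℝ) ≤ (L * (homNorm (z ◁ (r.R ≫ z' ◁ p)) * K)) ^ 2 := by nlinarith
    calc (1 : ℝ) ≤ (L * (homNorm (z ◁ (r.R ≫ z' ◁ p)) * K)) ^ 2 := e3
      _ = (L * K) ^ 2 * homNorm (z ◁ (r.R ≫ z' ◁ p)) ^ 2 := by ring
      _ = _ := by rw [e1]; ring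
  refine ⟨⌈(L * K) ^ 2 * M * c (𝟙 z)⌉₊, fun s hs horth => ?_⟩
  have hM : 0 ≤ (L * K) ^ 2 * M := mul_nonneg (sq_nonneg _) (homNorm_nonneg _)
  set q : z ⟶ z := 𝟙 z - ∑ p ∈ s, p with hq
  have hps : ∀ p ∈ s, p ≫ ∑ p' ∈ s, p' = p := by
    intro p hp
    rw [Preadditive.comp_sum, Finset.sum_eq_single p]
    · exact (hs p hp).1
    · intro b hb hbp
      exact horth p hp b hb hbp.symm
    · intro h
      exact absurd hp h
  have hqq : q ≫ q = q := by
    have : (∑ p ∈ s, p) ≫ q = 0 := by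
      rw [hq, Preadditive.comp_sub, Category.comp_id, Preadditive.sum_comp,
        Finset.sum_congr rfl hps, sub_self]
    nth_rw 1 [hq]
    rw [Preadditive.sub_comp, Category.id_comp, this, sub_zero]
  have hqs : adj q = q := by
    rw [hq, adj_sub, adj_id, adj_sum, Finset.sum_congr rfl fun p hp => (hs p hp).2.1]
  have hsum : c (𝟙 z) = ∑ p ∈ s, c p + c q := by
    have e : 𝟙 z = ∑ p ∈ s, p + q := by rw [hq]; simp
    have e2 : (c (𝟙 z) : ℂ) • 𝟙 (𝟙_ C) = ((∑ p ∈ s, c p + c q : ℝ) : ℂ) • 𝟙 (𝟙_ C) := by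
      rw [← hc (𝟙 z) (Category.comp_id _) (adj_id z)]
      conv_lhs => rw [e]
      rw [MonoidalPreadditive.whiskerLeft_add, whiskerLeft_sum,
        Preadditive.add_comp, Preadditive.comp_add, Preadditive.sum_comp, Preadditive.comp_sum,
        hc q hqq hqs, Finset.sum_congr rfl fun p hp => hc p (hs p hp).1 (hs p hp).2.1,
        ← Finset.sum_smul, ← add_smul]
      push_cast
      rfl
    exact_mod_cast h1.smul_id_injective e2
  have hcard : (s.card : ℝ) ≤ (L * K) ^ 2 * M * c (𝟙 z) := by
    calc (s.card : ℝ) = ∑ p ∈ s, (1 : ℝ) := by simp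
      _ ≤ ∑ p ∈ s, (L * K) ^ 2 * M * c p :=
        Finset.sum_le_sum fun p hp => hbound p (hs p hp).1 (hs p hp).2.1 (hs p hp).2.2
      _ = (L * K) ^ 2 * M * ∑ p ∈ s, c p := by rw [Finset.mul_sum]
      _ ≤ _ := mul_le_mul_of_nonneg_left (by rw [hsum]; linarith [hc0 q]) hM
  exact_mod_cast hcard.trans (Nat.le_ceil _)

theorem rangeProjection {k z : C} {f : k ⟶ z} (hf : f ≫ adj f = 𝟙 k) (hk : 𝟙 k ≠ 0) :
    (adj f ≫ f) ≫ (adj f ≫ f) = adj f ≫ f ∧ adj (adj f ≫ f) = adj f ≫ f ∧ adj f ≫ f ≠ 0 := by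
  refine ⟨?_, by rw [adj_comp, adj_adj], ?_⟩
  · rw [Category.assoc, ← Category.assoc f, hf, Category.id_comp]
  · intro h
    have h2 : (f ≫ adj f) ≫ (f ≫ adj f) = 0 := by
      rw [Category.assoc, ← Category.assoc (adj f), h]
      simp
    rw [hf, Category.comp_id] at h2
    exact hk h2

theorem rangeProjection_comp {k l z : C} {f : k ⟶ z} {g : l ⟶ z} (hfg : f ≫ adj g = 0) :
    (adj f ≫ f) ≫ (adj g ≫ g) = 0 := by
  rw [Category.assoc, ← Category.assoc f, hfg]
  simp

/-- A maximal orthonormal family in `C(k, z)` exists, since such families have mutually orthogonal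
range projections, and it spans by the Gram-Schmidt process. -/
theorem exists_orthonormal_basis (rigid : IsRigid C) (h1 : IsSimple (𝟙_ C)) {k : C}
    (hk : IsSimple k) (z : C) :
    ∃ (n : ℕ) (w : Fin n → (k ⟶ z)),
      (∀ a b, w a ≫ adj (w b) = if a = b then 𝟙 k else 0) ∧
      Submodule.span ℂ (Set.range w) = ⊤ := by
  classical
  obtain ⟨N, hN⟩ := exists_card_projections_le rigid h1 z
  let P : Finset (k ⟶ z) → Prop := fun s =>
    (∀ f ∈ s, f ≫ adj f = 𝟙 k) ∧ ∀ f ∈ s, ∀ g ∈ s, f ≠ g → f ≫ adj g = 0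
  have hP : ∀ s, P s → s.card ≤ N := by
    intro s ⟨hs1, hs2⟩
    have hinj : Set.InjOn (fun f : k ⟶ z => adj f ≫ f) s := by
      intro f hf g hg hfg
      by_contra hne
      have h2 := rangeProjection_comp (hs2 f hf g hg hne)
      have h3 := rangeProjection (hs1 g hg) hk.id_ne_zero
      simp only at hfg
      rw [hfg, h3.1] at h2
      exact h3.2.2 h2
    rw [← Finset.card_image_of_injOn hinj]
    apply hN
    · intro p hp
      obtain ⟨f, hf, rfl⟩ := Finset.mem_image.1 hp
      exact rangeProjection (hs1 f hf) hk.id_ne_zero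
    · intro p hp q hq hpq
      obtain ⟨f, hf, rfl⟩ := Finset.mem_image.1 hp
      obtain ⟨g, hg, rfl⟩ := Finset.mem_image.1 hq
      exact rangeProjection_comp (hs2 f hf g hg fun h => hpq (by rw [h]))
  have hspan : ∃ s, P s ∧ Submodule.span ℂ (s : Set (k ⟶ z)) = ⊤ := by
    by_contra hcon
    push Not at hcon
    have hgrow : ∀ n : ℕ, ∃ s, P s ∧ s.card = n := by
      intro n
      induction n with
      | zero => exact ⟨∅, ⟨by simp, by simp⟩, rfl⟩
      | succ n ih =>
        obtain ⟨s, hs, hcard⟩ := ih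
        obtain ⟨σ, hσ⟩ : ∃ σ : k ⟶ z, σ ∉ Submodule.span ℂ (s : Set (k ⟶ z)) := by
          by_contra hall
          push Not at hall
          exact hcon s hs (eq_top_iff.2 fun x _ => hall x)
        choose c hc using fun f : k ⟶ z => hk.exists_smul (σ ≫ adj f)
        set τ : k ⟶ z := σ - ∑ f ∈ s, c f • f with hτ
        have hτ0 : τ ≠ 0 := by
          intro h
          apply hσ
          rw [sub_eq_zero.1 h]
          exact Submodule.sum_mem _ fun f hf =>
            Submodule.smul_mem _ _ (Submodule.subset_span hf)
        have hτf : ∀ f ∈ s, τ ≫ adj f = 0 := by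
          intro f hf
          rw [hτ, Preadditive.sub_comp, Preadditive.sum_comp, Finset.sum_eq_single f]
          · rw [Linear.smul_comp, hs.1 f hf, hc f, sub_self]
          · intro g hg hgf
            rw [Linear.smul_comp, hs.2 g hg f hf hgf, smul_zero]
          · intro h
            exact absurd hf h
        obtain ⟨d, hd, hdτ⟩ := hk.exists_pos hτ0
        set ω : k ⟶ z := (((Real.sqrt d)⁻¹ : ℝ) : ℂ) • τ with hω
        have hωω : ω ≫ adj ω = 𝟙 k := by
          rw [hω, adj_smul, Linear.smul_comp, Linear.comp_smul, hdτ, smul_smul, smul_smul]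
          have : (((Real.sqrt d)⁻¹ : ℝ) : ℂ) * star (((Real.sqrt d)⁻¹ : ℝ) : ℂ) * (d : ℂ) = 1 := by
            have h2 : star (((Real.sqrt d)⁻¹ : ℝ) : ℂ) = (((Real.sqrt d)⁻¹ : ℝ) : ℂ) :=
              Complex.conj_ofReal _
            rw [h2]
            norm_cast
            rw [← mul_inv, Real.mul_self_sqrt hd.le, inv_mul_cancel₀ hd.ne']
          rw [this, one_smul]
        have hωf : ∀ f ∈ s, ω ≫ adj f = 0 := fun f hf => by
          rw [hω, Linear.smul_comp, hτf f hf, smul_zero]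
        have hωs : ω ∉ s := fun hmem => hk.id_ne_zero (by rw [← hωω, hωf ω hmem])
        have hfω : ∀ f ∈ s, f ≫ adj ω = 0 := fun f hf => by
          have := congrArg adj (hωf f hf)
          rwa [adj_comp, adj_adj, adj_zero] at this
        refine ⟨insert ω s, ⟨?_, ?_⟩, by rw [Finset.card_insert_of_notMem hωs, hcard]⟩
        · intro f hf
          rcases Finset.mem_insert.1 hf with rfl | hf
          · exact hωω
          · exact hs.1 f hf
        · intro f hf g hg hfg
          rcases Finset.mem_insert.1 hf with rfl | hf
          · exact hωf g ((Finset.mem_insert.1 hg).resolve_left hfg.symm)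
          · rcases Finset.mem_insert.1 hg with rfl | hg
            · exact hfω f hf
            · exact hs.2 f hf g hg hfg
    obtain ⟨s, hs, hcard⟩ := hgrow (N + 1)
    have := hP s hs
    omega
  obtain ⟨s, hs, hspan⟩ := hspan
  refine ⟨s.card, fun i => (s.equivFin.symm i).1, ?_, ?_⟩
  · intro a b
    split_ifs with hab
    · subst hab
      exact hs.1 _ (s.equivFin.symm a).2
    · refine hs.2 _ (s.equivFin.symm a).2 _ (s.equivFin.symm b).2 fun h => hab ?_
      exact s.equivFin.symm.injective (Subtype.ext h)
  · rw [← hspan]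
    congr 1
    ext f
    constructor
    · rintro ⟨i, rfl⟩
      exact (s.equivFin.symm i).2
    · intro hf
      exact ⟨s.equivFin ⟨f, hf⟩, by simp⟩

/-- Endomorphisms of `X` embed in `C(𝟙, Y ⊗ X)`, for a conjugate `Y` of `X`. -/
theorem finiteDimensional_end (rigid : IsRigid C) (h1 : IsSimple (𝟙_ C)) (X : C) :
    FiniteDimensional ℂ (X ⟶ X) := by
  obtain ⟨Y, ⟨r⟩⟩ := rigid X
  obtain ⟨n, w, -, hw⟩ := exists_orthonormal_basis rigid h1 h1 (Y ⊗ X)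
  have : FiniteDimensional ℂ (𝟙_ C ⟶ Y ⊗ X) := by
    refine Module.finite_def.2 ?_
    rw [← hw]
    exact Submodule.fg_span (Set.finite_range w)
  let φ : (X ⟶ X) →ₗ[ℂ] (𝟙_ C ⟶ Y ⊗ X) :=
    { toFun := fun f => r.R ≫ Y ◁ f
      map_add' := by intros; simp
      map_smul' := by intros; simp }
  exact FiniteDimensional.of_injective φ fun f g h => r.R_comp_injective h

/-! ### Semisimplicity -/

theorem isSimple_of_projections_trivial (rigid : IsRigid C) (h1 : IsSimple (𝟙_ C)) {X : C}
    (hX : 𝟙 X ≠ 0) (hproj : ∀ p : X ⟶ X, p ≫ p = p → adj p = p → p = 0 ∨ p = 𝟙 X) :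
    IsSimple X := by
  let S : StarRing (End X) :=
    { star := fun f => (adj (show X ⟶ X from f) : X ⟶ X)
      star_involutive := fun f => adj_adj (show X ⟶ X from f)
      star_mul := fun f g => adj_comp (show X ⟶ X from g) (show X ⟶ X from f)
      star_add := fun f g => adj_add (show X ⟶ X from f) (show X ⟶ X from g) }
  have : FiniteDimensional ℂ (End X) := finiteDimensional_end rigid h1 X
  have : Nontrivial (End X) := ⟨⟨𝟙 X, 0, hX⟩⟩
  intro f
  obtain ⟨c, hc⟩ := exists_eq_algebraMap_of_projections_trivial (A := End X)
    (fun x hx => eq_zero_of_comp_adj (C := C) (X := X) (Y := X) hx)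
    (fun p hp hs => hproj p hp hs)
    (fun c x => adj_smul (X := X) (Y := X) c x) f
  rw [Algebra.algebraMap_eq_smul_one] at hc
  refine ⟨c, hc, fun d hd => ?_⟩
  have h2 : (d - c) • 𝟙 X = 0 := by
    rw [sub_smul, sub_eq_zero]
    exact hd.symm.trans hc
  exact sub_eq_zero.1 ((smul_eq_zero.1 h2).resolve_right hX)

/-- Every nonzero object has a simple subobject: a nontrivial projection cuts out a subobject with a
smaller endomorphism algebra. -/
theorem exists_simple_subobject (rigid : IsRigid C) (h1 : IsSimple (𝟙_ C)) {X : C}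
    (hX : 𝟙 X ≠ 0) : ∃ (k : C) (i : k ⟶ X), IsSimple k ∧ i ≫ adj i = 𝟙 k := by
  induction hn : Module.finrank ℂ (X ⟶ X) using Nat.strong_induction_on generalizing X with
  | _ n ih =>
    by_cases hs : IsSimple X
    · exact ⟨X, 𝟙 X, hs, by rw [adj_id, Category.comp_id]⟩
    obtain ⟨p, hp, hps, hp0, hp1⟩ : ∃ p : X ⟶ X, p ≫ p = p ∧ adj p = p ∧ p ≠ 0 ∧ p ≠ 𝟙 X := by
      by_contra hcon
      push Not at hcon
      exact hs (isSimple_of_projections_trivial rigid h1 hX fun p hp hps =>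
        or_iff_not_imp_left.2 (hcon p hp hps))
    obtain ⟨Y, j, hj1, hj2⟩ := exists_subobject p hp hps
    have hY : 𝟙 Y ≠ 0 := by
      intro h
      apply hp0
      rw [← hj2, ← Category.id_comp j, h]
      simp
    let φ : (Y ⟶ Y) →ₗ[ℂ] (X ⟶ X) :=
      { toFun := fun f => adj j ≫ f ≫ j
        map_add' := by intros; simp
        map_smul' := by intros; simp }
    have hφ : Function.Injective φ := by
      intro f g h
      have h2 : j ≫ (adj j ≫ f ≫ j) ≫ adj j = j ≫ (adj j ≫ g ≫ j) ≫ adj j :=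
        congrArg (fun t => j ≫ t ≫ adj j) h
      simp only [Category.assoc, hj1, Category.comp_id] at h2
      rwa [← Category.assoc, hj1, Category.id_comp, ← Category.assoc, hj1, Category.id_comp] at h2
    have := finiteDimensional_end rigid h1 X
    have hlt : Module.finrank ℂ (Y ⟶ Y) < n := by
      rw [← hn, ← LinearMap.finrank_range_of_inj hφ]
      apply Submodule.finrank_lt
      rw [Ne, eq_top_iff]
      intro h
      obtain ⟨f, hf⟩ := h (Submodule.mem_top (x := 𝟙 X))
      apply hp1
      have hf' : adj j ≫ f ≫ j = 𝟙 X := hf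
      rw [← Category.comp_id p, ← hj2, ← hf']
      simp only [Category.assoc]
      rw [← Category.assoc j, hj1, Category.id_comp]
    obtain ⟨k, i, hk, hi⟩ := ih _ hlt hY rfl
    refine ⟨k, i ≫ j, hk, ?_⟩
    rw [adj_comp, Category.assoc, ← Category.assoc j, hj1, Category.id_comp, hi]

namespace TubeChoices

variable (D : TubeChoices C)

theorem mem_supp {k : Irr C} {z : C} : k ∈ D.supp z ↔ D.card k z ≠ 0 := by
  simp [supp]

/-- Semisimplicity: the range projections of the orthonormal bases of all the spaces `C(k, z)` sum
up to the identity of `z`. -/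
theorem sum_adj_comp_onb (rigid : IsRigid C) (h1 : IsSimple (𝟙_ C)) (z : C) :
    ∑ k ∈ D.supp z, ∑ a, adj (D.onb k z a) ≫ D.onb k z a = 𝟙 z := by
  set e : z ⟶ z := ∑ k ∈ D.supp z, ∑ a, adj (D.onb k z a) ≫ D.onb k z a with he
  have hs : adj e = e := by
    simp only [he, adj_sum, adj_comp, adj_adj]
  have hve : ∀ k a, D.onb k z a ≫ e = D.onb k z a := by
    intro k a
    have hk : k ∈ D.supp z := by
      rw [mem_supp]
      intro h0
      exact (Fin.cast h0 a).elim0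
    simp only [he, Preadditive.comp_sum]
    rw [Finset.sum_eq_single k, Finset.sum_eq_single a]
    · rw [← Category.assoc, D.onb_orthonormal, if_pos rfl, Category.id_comp]
    · intro b _ hb
      rw [← Category.assoc, D.onb_orthonormal, if_neg hb.symm, Limits.zero_comp]
    · simp
    · intro l _ hl
      refine Finset.sum_eq_zero fun b _ => ?_
      rw [← Category.assoc, Irr.hom_eq_zero h1 hl.symm (D.onb k z a ≫ adj (D.onb l z b)),
        Limits.zero_comp]
    · intro h
      exact absurd hk h
  have hσ : ∀ (k : Irr C) (σ : k.obj ⟶ z), σ ≫ (𝟙 z - e) = 0 := by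
    intro k σ
    have hmem : σ ∈ Submodule.span ℂ (Set.range (D.onb k z)) := by
      rw [D.onb_span]
      trivial
    induction hmem using Submodule.span_induction with
    | mem x hx =>
      obtain ⟨a, rfl⟩ := hx
      rw [Preadditive.comp_sub, Category.comp_id, hve, sub_self]
    | zero => simp
    | add x y _ _ hx hy => rw [Preadditive.add_comp, hx, hy, add_zero]
    | smul c x _ hx => rw [Linear.smul_comp, hx, smul_zero]
  have hee : e ≫ e = e := by
    nth_rw 1 [he]
    rw [he]
    simp only [Preadditive.sum_comp, Category.assoc]
    rw [← he]
    simp only [hve]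
    exact he.symm
  set q : z ⟶ z := 𝟙 z - e with hq
  have hqq : q ≫ q = q := by
    rw [hq, Preadditive.sub_comp, Preadditive.comp_sub, Preadditive.comp_sub, hee]
    simp
  have hqs : adj q = q := by rw [hq, adj_sub, adj_id, hs]
  by_contra hne
  obtain ⟨y, j, hj1, hj2⟩ := exists_subobject q hqq hqs
  have hy : 𝟙 y ≠ 0 := by
    intro h
    apply hne
    have : q = 0 := by
      rw [← hj2, ← Category.id_comp j, h]
      simp
    exact (sub_eq_zero.1 this).symm
  obtain ⟨k, i, hk, hi⟩ := exists_simple_subobject rigid h1 hy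
  obtain ⟨w, ⟨t⟩, -⟩ := Irr.existsUnique k hk
  have h3 := hσ w (t.inv ≫ i ≫ j)
  rw [← hj2] at h3
  have h4 : t.hom ≫ ((t.inv ≫ i ≫ j) ≫ adj j ≫ j) ≫ adj j ≫ adj i = 0 := by
    rw [h3]
    simp
  simp only [Category.assoc, Iso.hom_inv_id_assoc] at h4
  rw [← Category.assoc j, hj1, Category.id_comp, ← Category.assoc j, hj1, Category.id_comp, hi]
    at h4
  exact hk.id_ne_zero h4

end TubeChoices

/-! ### Existence of the choices -/

namespace ConjugateSolution

variable {X Y : C}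

theorem R_ne_zero (r : ConjugateSolution X Y) (hX : 𝟙 X ≠ 0) : r.R ≠ 0 := by
  intro h
  apply hX
  rw [← r.conj_right, h, adj_zero]
  simp

theorem Rbar_ne_zero (r : ConjugateSolution X Y) (hX : 𝟙 X ≠ 0) : r.Rbar ≠ 0 := by
  intro h
  apply hX
  rw [← r.conj_right, h]
  simp

/-- A conjugate of a simple object is simple. -/
theorem isSimple (r : ConjugateSolution X Y) (hX : IsSimple X) : IsSimple Y := by
  have hY : 𝟙 Y ≠ 0 := by
    intro h
    apply r.R_ne_zero hX.id_ne_zero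
    rw [← Category.comp_id r.R, ← id_whiskerRight, h]
    simp
  intro f
  let _ := r.swap.exactPairing
  obtain ⟨c, hc⟩ := hX.exists_smul (dualMap Y X X f)
  have h := coev_dualMap (z' := X) (w' := X) f
  rw [hc] at h
  change r.R ≫ Y ◁ (c • 𝟙 X) = r.R ≫ f ▷ X at h
  have hf : f = c • 𝟙 Y := by
    have key : ∀ g : Y ⟶ Y, (λ_ Y).inv ≫ (r.R ≫ g ▷ X) ▷ Y ≫ (α_ Y X Y).hom ≫ Y ◁ adj r.Rbar ≫
        (ρ_ Y).hom = g := by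
      intro g
      calc
        _ = 𝟙 _ ⊗≫ r.R ▷ Y ⊗≫ (g ▷ (X ⊗ Y) ≫ Y ◁ adj r.Rbar) ⊗≫ 𝟙 _ := by monoidal
        _ = ((λ_ Y).inv ≫ r.R ▷ Y ≫ (α_ Y X Y).hom ≫ Y ◁ adj r.Rbar ≫ (ρ_ Y).hom) ≫ g := by
          rw [← whisker_exchange]; monoidal
        _ = g := by rw [r.conj_left, Category.id_comp]
    rw [← key f, ← h]
    have e : r.R ≫ Y ◁ (c • 𝟙 X) = r.R ≫ (c • 𝟙 Y) ▷ X := by simp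
    rw [e, key]
  refine ⟨c, hf, fun d hd => ?_⟩
  have h2 : (d - c) • 𝟙 Y = 0 := by
    rw [sub_smul, sub_eq_zero, ← hf]
    exact hd.symm
  exact sub_eq_zero.1 ((smul_eq_zero.1 h2).resolve_right hY)

/-- Transport of a solution along an isomorphism of the conjugate. -/
def transport (r : ConjugateSolution X Y) {Z : C} (e : Y ≅ Z) : ConjugateSolution X Z where
  R := r.R ≫ e.hom ▷ X
  Rbar := r.Rbar ≫ X ◁ adj e.inv
  conj_left := by
    rw [adj_comp, adj_whiskerLeft, adj_adj]
    calc
      _ = 𝟙 _ ⊗≫ r.R ▷ Z ⊗≫ (e.hom ▷ (X ⊗ Z) ≫ Z ◁ (X ◁ e.inv ≫ adj r.Rbar)) ⊗≫ 𝟙 _ := by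
        monoidal
      _ = 𝟙 _ ⊗≫ (r.R ▷ Z ≫ (Y ⊗ X) ◁ e.inv) ⊗≫ Y ◁ adj r.Rbar ⊗≫ e.hom ⊗≫ 𝟙 _ := by
        rw [← whisker_exchange]; monoidal
      _ = e.inv ≫ ((λ_ Y).inv ≫ r.R ▷ Y ≫ (α_ Y X Y).hom ≫ Y ◁ adj r.Rbar ≫ (ρ_ Y).hom) ≫
          e.hom := by
        rw [← whisker_exchange]; monoidal
      _ = 𝟙 Z := by
        rw [r.conj_left]
        simp
  conj_right := by
    rw [adj_comp, adj_whiskerRight]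
    calc
      _ = 𝟙 _ ⊗≫ r.Rbar ▷ X ⊗≫ X ◁ (adj e.inv ≫ adj e.hom) ▷ X ⊗≫ X ◁ adj r.R ⊗≫ 𝟙 _ := by
        monoidal
      _ = (λ_ X).inv ≫ r.Rbar ▷ X ≫ (α_ X Y X).hom ≫ X ◁ adj r.R ≫ (ρ_ X).hom := by
        rw [← adj_comp, e.hom_inv_id, adj_id]; monoidal
      _ = 𝟙 X := r.conj_right

/-- Rescaling of a solution by a nonzero real number. -/
noncomputable def rescale (r : ConjugateSolution X Y) (t : ℝ) (ht : t ≠ 0) : ConjugateSolution X Y where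
  R := (t : ℂ) • r.R
  Rbar := ((t⁻¹ : ℝ) : ℂ) • r.Rbar
  conj_left := by
    have h : star ((t⁻¹ : ℝ) : ℂ) = ((t⁻¹ : ℝ) : ℂ) := Complex.conj_ofReal _
    have h2 : ((t⁻¹ : ℝ) : ℂ) * (t : ℂ) = 1 := by
      norm_cast
      exact inv_mul_cancel₀ ht
    simp only [adj_smul, h, MonoidalLinear.smul_whiskerRight, MonoidalLinear.whiskerLeft_smul,
      Linear.smul_comp, Linear.comp_smul, smul_smul, r.conj_left, h2, one_smul]
  conj_right := by
    have h : star (t : ℂ) = (t : ℂ) := Complex.conj_ofReal _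
    have h2 : ((t⁻¹ : ℝ) : ℂ) * (t : ℂ) = 1 := by
      norm_cast
      exact inv_mul_cancel₀ ht
    simp only [adj_smul, h, MonoidalLinear.smul_whiskerRight, MonoidalLinear.whiskerLeft_smul,
      Linear.smul_comp, Linear.comp_smul, smul_smul, r.conj_right, h2, mul_comm (t : ℂ), one_smul]

/-- For a simple object, a solution can be rescaled to a standard one. -/
theorem exists_isStandard (r : ConjugateSolution X Y) (h1 : IsSimple (𝟙_ C)) (hX : IsSimple X) :
    ∃ s : ConjugateSolution X Y, s.IsStandard := by
  obtain ⟨a, ha, haR⟩ := h1.exists_pos (r.R_ne_zero hX.id_ne_zero)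
  obtain ⟨b, hb, hbR⟩ := h1.exists_pos (r.Rbar_ne_zero hX.id_ne_zero)
  -- the rescaled `R` and `Rbar` have equal norms if `t ^ 2 * a = t⁻¹ ^ 2 * b`
  set t : ℝ := Real.sqrt (Real.sqrt (b / a)) with ht
  have hba : 0 < b / a := div_pos hb ha
  have ht0 : 0 < t := Real.sqrt_pos.2 (Real.sqrt_pos.2 hba)
  have ht4 : t * t * a = t⁻¹ * t⁻¹ * b := by
    have h4 : t * t * (t * t) = b / a := by
      rw [ht, Real.mul_self_sqrt (Real.sqrt_nonneg _), Real.mul_self_sqrt hba.le]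
    have h5 : t * t * (t * t) * a = b := by
      rw [h4, div_mul_cancel₀ _ ha.ne']
    rw [← h5]
    field_simp
  refine ⟨r.rescale t ht0.ne', fun f => ?_⟩
  obtain ⟨c, rfl⟩ := hX.exists_smul f
  have hs : star (t : ℂ) = (t : ℂ) := Complex.conj_ofReal _
  have hs' : star ((t⁻¹ : ℝ) : ℂ) = ((t⁻¹ : ℝ) : ℂ) := Complex.conj_ofReal _
  have ht4' : (t : ℂ) * t * a = ((t⁻¹ : ℝ) : ℂ) * ((t⁻¹ : ℝ) : ℂ) * b := by exact_mod_cast ht4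
  simp only [rescale, adj_smul, hs, hs', MonoidalLinear.smul_whiskerRight,
    MonoidalLinear.whiskerLeft_smul, whiskerLeft_id, id_whiskerRight, Linear.smul_comp,
    Linear.comp_smul, smul_smul, Category.id_comp, haR, hbR]
  congr 1
  linear_combination c * ht4'

end ConjugateSolution

theorem nonempty_tubeChoices (rigid : IsRigid C) (h1 : IsSimple (𝟙_ C)) :
    Nonempty (TubeChoices C) := by
  have hconj : ∀ k : Irr C, ∃ (l : Irr C) (r : ConjugateSolution k.obj l.obj), r.IsStandard := by
    intro k
    obtain ⟨Y, ⟨r⟩⟩ := rigid k.obj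
    obtain ⟨l, ⟨e⟩, -⟩ := Irr.existsUnique Y (r.isSimple (k.isSimple_obj h1))
    exact ⟨l, (r.transport e).exists_isStandard h1 (k.isSimple_obj h1)⟩
  choose conj sol hsol using hconj
  choose card onb honb hspan using fun (k : Irr C) (z : C) =>
    exists_orthonormal_basis rigid h1 (k.isSimple_obj h1) z
  refine ⟨⟨conj, sol, hsol, card, onb, honb, hspan, fun z => ?_⟩⟩
  obtain ⟨N, hN⟩ := exists_card_projections_le rigid h1 z
  by_contra hinf
  obtain ⟨F, hF, hcard⟩ := Set.Infinite.exists_subset_card_eq hinf (N + 1)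
  classical
  have hpos : ∀ k ∈ F, 0 < card k z := fun k hk => Nat.pos_of_ne_zero (hF hk)
  -- one range projection for each simple object with a nonzero morphism to `z`
  let p : Irr C → (z ⟶ z) := fun k =>
    if h : 0 < card k z then adj (onb k z ⟨0, h⟩) ≫ onb k z ⟨0, h⟩ else 0
  have hp : ∀ k ∈ F, p k ≫ p k = p k ∧ adj (p k) = p k ∧ p k ≠ 0 := by
    intro k hk
    simp only [p, dif_pos (hpos k hk)]
    exact rangeProjection (by rw [honb, if_pos rfl]) (k.isSimple_obj h1).id_ne_zero
  have horth : ∀ k ∈ F, ∀ l ∈ F, k ≠ l → p k ≫ p l = 0 := by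
    intro k hk l hl hkl
    simp only [p, dif_pos (hpos k hk), dif_pos (hpos l hl)]
    exact rangeProjection_comp (Irr.hom_eq_zero h1 hkl _)
  have hinj : Set.InjOn p F := by
    intro k hk l hl hkl
    by_contra hne
    have h2 := horth k hk l hl hne
    rw [hkl, (hp l hl).1] at h2
    exact (hp l hl).2.2 h2
  have h3 := hN (F.image p)
    (fun q hq => by
      obtain ⟨k, hk, rfl⟩ := Finset.mem_image.1 hq
      exact hp k hk)
    (fun q hq q' hq' hne => by
      obtain ⟨k, hk, rfl⟩ := Finset.mem_image.1 hq
      obtain ⟨l, hl, rfl⟩ := Finset.mem_image.1 hq'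
      exact horth k hk l hl fun h => hne (by rw [h]))
  rw [Finset.card_image_of_injOn hinj, hcard] at h3
  omega

end

section

variable {C : Type u} [Category.{v} C] [Preadditive C] [Linear ℂ C]
  [MonoidalCategory C] [MonoidalPreadditive C] [MonoidalLinear ℂ C] [CStarTensorCategory C]

open CStarCategory CStarTensorCategory

namespace TubeChoices

variable (D : TubeChoices C)

/-! ### The maps `Ψ` -/

/-- The inclusion of `C(w ⊗ x, y ⊗ w)` in `A_{x,y}`. -/
noncomputable abbrev tubeOf (x y w : Irr C) :
    (w.obj ⊗ x.obj ⟶ y.obj ⊗ w.obj) →ₗ[ℂ] TubeSpace x y :=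
  DirectSum.lof ℂ (Irr C) (fun w => (w.obj ⊗ x.obj ⟶ y.obj ⊗ w.obj)) w

omit [MonoidalPreadditive C] [MonoidalLinear ℂ C] [CStarTensorCategory C] in
theorem tube_induction {x y : Irr C} {P : TubeSpace x y → Prop} (a : TubeSpace x y)
    (h0 : P 0) (hof : ∀ w γ, P (tubeOf x y w γ)) (hadd : ∀ a b, P a → P b → P (a + b)) : P a :=
  DirectSum.induction_on a h0 hof hadd

theorem psi_apply (x y : Irr C) (z : C) (γ : z ⊗ x.obj ⟶ y.obj ⊗ z) :
    D.psi x y z γ = ∑ k ∈ D.supp z, ∑ a, tubeOf x y k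
      (D.onb k z a ▷ x.obj ≫ γ ≫ y.obj ◁ adj (D.onb k z a)) := by
  simp only [psi, LinearMap.sum_apply, LinearMap.comp_apply, map_sum]
  rfl

/-- Cyclicity for morphisms of simple objects, by Schur's lemma. -/
theorem tubeOf_cyclic (h1 : IsSimple (𝟙_ C)) (x y : Irr C) {w w' : Irr C} (θ : w.obj ⟶ w'.obj)
    (δ : w'.obj ⊗ x.obj ⟶ y.obj ⊗ w.obj) :
    tubeOf x y w (θ ▷ x.obj ≫ δ) = tubeOf x y w' (δ ≫ y.obj ◁ θ) := by
  by_cases h : w = w'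
  · subst h
    obtain ⟨c, rfl⟩ := (w.isSimple_obj h1).exists_smul θ
    simp
  · rw [Irr.hom_eq_zero h1 h θ]
    simp

/-- The trace property of `Ψ`. -/
theorem psi_cyclic (rigid : IsRigid C) (h1 : IsSimple (𝟙_ C)) (x y : Irr C) {z z' : C}
    (T : z' ⟶ z) (δ : z ⊗ x.obj ⟶ y.obj ⊗ z') :
    D.psi x y z' (T ▷ x.obj ≫ δ) = D.psi x y z (δ ≫ y.obj ◁ T) := by
  have e1 : ∀ (k : Irr C) (a : Fin (D.card k z')),
      D.onb k z' a ▷ x.obj ≫ (T ▷ x.obj ≫ δ) ≫ y.obj ◁ adj (D.onb k z' a) =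
        ∑ l ∈ D.supp z, ∑ b, (D.onb k z' a ≫ T ≫ adj (D.onb l z b)) ▷ x.obj ≫
          (D.onb l z b ▷ x.obj ≫ δ ≫ y.obj ◁ adj (D.onb k z' a)) := by
    intro k a
    have : T = ∑ l ∈ D.supp z, ∑ b, T ≫ adj (D.onb l z b) ≫ D.onb l z b := by
      simp only [← Preadditive.comp_sum]
      rw [D.sum_adj_comp_onb rigid h1, Category.comp_id]
    conv_lhs => rw [this]
    simp only [sum_whiskerRight, Preadditive.comp_sum, Preadditive.sum_comp, comp_whiskerRight,
      Category.assoc]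
  have e2 : ∀ (l : Irr C) (b : Fin (D.card l z)),
      D.onb l z b ▷ x.obj ≫ (δ ≫ y.obj ◁ T) ≫ y.obj ◁ adj (D.onb l z b) =
        ∑ k ∈ D.supp z', ∑ a, (D.onb l z b ▷ x.obj ≫ δ ≫ y.obj ◁ adj (D.onb k z' a)) ≫
          y.obj ◁ (D.onb k z' a ≫ T ≫ adj (D.onb l z b)) := by
    intro l b
    have : T = ∑ k ∈ D.supp z', ∑ a, (adj (D.onb k z' a) ≫ D.onb k z' a) ≫ T := by
      simp only [← Preadditive.sum_comp]
      rw [D.sum_adj_comp_onb rigid h1, Category.id_comp]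
    conv_lhs => rw [this]
    simp only [whiskerLeft_sum, Preadditive.comp_sum, Preadditive.sum_comp, whiskerLeft_comp,
      Category.assoc]
  simp only [psi_apply, e1, e2, map_sum]
  rw [Finset.sum_congr rfl fun k _ => Finset.sum_comm, Finset.sum_comm]
  refine Finset.sum_congr rfl fun l _ => ?_
  rw [Finset.sum_congr rfl fun k _ => Finset.sum_comm, Finset.sum_comm]
  simp only [tubeOf_cyclic h1]

theorem psi_simple (rigid : IsRigid C) (h1 : IsSimple (𝟙_ C)) (x y w : Irr C)
    (γ : w.obj ⊗ x.obj ⟶ y.obj ⊗ w.obj) : D.psi x y w.obj γ = tubeOf x y w γ := by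
  simp only [psi_apply, tubeOf_cyclic h1, Category.assoc, ← whiskerLeft_comp]
  simp only [tubeOf, ← map_sum, ← Preadditive.comp_sum,
    ← whiskerLeft_sum]
  rw [D.sum_adj_comp_onb rigid h1, whiskerLeft_id, Category.comp_id]

theorem psi_iso (rigid : IsRigid C) (h1 : IsSimple (𝟙_ C)) (x y : Irr C) {z z' : C} (e : z ≅ z')
    (γ : z' ⊗ x.obj ⟶ y.obj ⊗ z') :
    D.psi x y z (e.hom ▷ x.obj ≫ γ ≫ y.obj ◁ e.inv) = D.psi x y z' γ := by
  rw [D.psi_cyclic rigid h1]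
  simp [← whiskerLeft_comp]

/-! ### The product of tubes -/

theorem spaceMul_tubeOf (x s y m l : Irr C) (γ₁ : m.obj ⊗ s.obj ⟶ y.obj ⊗ m.obj)
    (γ₂ : l.obj ⊗ x.obj ⟶ s.obj ⊗ l.obj) :
    D.spaceMul x s y (tubeOf s y m γ₁) (tubeOf x s l γ₂) =
      D.psi x y (m.obj ⊗ l.obj) (tubeComp γ₁ γ₂) := by
  simp only [spaceMul, tubeOf, DirectSum.toModule_lof, LinearMap.flip_apply]
  rfl

theorem spaceMul_psi (rigid : IsRigid C) (h1 : IsSimple (𝟙_ C)) (x s y : Irr C) {z z' : C}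
    (γ : z ⊗ s.obj ⟶ y.obj ⊗ z) (γ' : z' ⊗ x.obj ⟶ s.obj ⊗ z') :
    D.spaceMul x s y (D.psi s y z γ) (D.psi x s z' γ') = D.psi x y (z ⊗ z') (tubeComp γ γ') := by
  have e : tubeComp γ γ' = tubeComp γ γ' ≫ y.obj ◁
      ((∑ k ∈ D.supp z, ∑ a, adj (D.onb k z a) ≫ D.onb k z a) ⊗ₘ
        (∑ l ∈ D.supp z', ∑ b, adj (D.onb l z' b) ≫ D.onb l z' b)) := by
    rw [D.sum_adj_comp_onb rigid h1, D.sum_adj_comp_onb rigid h1]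
    simp
  rw [e]
  simp only [psi_apply D s y z, psi_apply D x s z', map_sum, LinearMap.sum_apply, spaceMul_tubeOf,
    tubeComp_conj, tensor_sum, sum_tensor, whiskerLeft_sum, Preadditive.comp_sum]
  simp only [D.psi_cyclic rigid h1 x y (_ ⊗ₘ _), Category.assoc, ← whiskerLeft_comp,
    tensorHom_comp_tensorHom]

theorem spaceMul_assoc (rigid : IsRigid C) (h1 : IsSimple (𝟙_ C)) {x s t y : Irr C}
    (a : TubeSpace t y) (b : TubeSpace s t) (c : TubeSpace x s) :
    D.spaceMul x s y (D.spaceMul s t y a b) c = D.spaceMul x t y a (D.spaceMul x s t b c) := by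
  induction a using tube_induction with
  | h0 => simp
  | hadd a a' ha ha' => simp only [map_add, LinearMap.add_apply, ha, ha']
  | hof m γ₁ =>
  induction b using tube_induction with
  | h0 => simp
  | hadd b b' hb hb' => simp only [map_add, LinearMap.add_apply, hb, hb']
  | hof l γ₂ =>
  induction c using tube_induction with
  | h0 => simp
  | hadd c c' hc hc' => simp only [map_add, hc, hc']
  | hof n γ₃ =>
  simp only [← D.psi_simple rigid h1, D.spaceMul_psi rigid h1]
  rw [tubeComp_assoc]
  exact D.psi_iso rigid h1 x y (α_ m.obj l.obj n.obj) _

theorem one_spaceMul (rigid : IsRigid C) (h1 : IsSimple (𝟙_ C)) {x y : Irr C}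
    (a : TubeSpace x y) :
    D.spaceMul x y y (tubeOf y y .one ((λ_ y.obj).hom ≫ (ρ_ y.obj).inv)) a = a := by
  induction a using tube_induction with
  | h0 => simp
  | hadd a a' ha ha' => simp only [map_add, ha, ha']
  | hof w γ =>
  rw [spaceMul_tubeOf, ← D.psi_simple rigid h1, ← D.psi_iso rigid h1 x y (λ_ w.obj)]
  congr 1
  simp only [tubeComp, Irr.obj]
  monoidal

theorem spaceMul_one (rigid : IsRigid C) (h1 : IsSimple (𝟙_ C)) {x y : Irr C}
    (a : TubeSpace x y) :
    D.spaceMul x x y a (tubeOf x x .one ((λ_ x.obj).hom ≫ (ρ_ x.obj).inv)) = a := by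
  induction a using tube_induction with
  | h0 => simp
  | hadd a a' ha ha' => simp only [map_add, LinearMap.add_apply, ha, ha']
  | hof w γ =>
  rw [spaceMul_tubeOf, ← D.psi_simple rigid h1, ← D.psi_iso rigid h1 x y (ρ_ w.obj)]
  congr 1
  simp only [tubeComp, Irr.obj]
  monoidal

/-! ### The involution on tubes -/

theorem spaceStar_tubeOf (x y w : Irr C) (γ : w.obj ⊗ x.obj ⟶ y.obj ⊗ w.obj) :
    D.spaceStar x y (tubeOf x y w γ) =
      tubeOf y x (D.conj w) (@turn _ _ _ _ _ (D.sol w).exactPairing _ _ (adj γ)) := by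
  unfold spaceStar
  exact DirectSum.toAddMonoid_of _ _ _

omit [Linear ℂ C] [MonoidalLinear ℂ C] [CStarTensorCategory C] in
theorem dualMap_sum {z z' w w' : C} [ExactPairing z z'] [ExactPairing w w'] {ι : Type*}
    (s : Finset ι) (f : ι → (w ⟶ z)) :
    dualMap z z' w' (∑ i ∈ s, f i) = ∑ i ∈ s, dualMap z z' w' (f i) := by
  simp only [dualMap, rightAdjointMate, sum_whiskerRight, whiskerLeft_sum, Preadditive.comp_sum,
    Preadditive.sum_comp]

/-- The involution intertwines `Ψ^z` with `Ψ^{z'}` for every dual `z'` of `z`. -/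
theorem spaceStar_psi (rigid : IsRigid C) (h1 : IsSimple (𝟙_ C)) (x y : Irr C) {z z' : C}
    [ExactPairing z z'] (γ : z ⊗ x.obj ⟶ y.obj ⊗ z) :
    D.spaceStar x y (D.psi x y z γ) = D.psi y x z' (turn z z' (adj γ)) := by
  let I : ∀ k : Irr C, ExactPairing k.obj (D.conj k).obj := fun k => (D.sol k).exactPairing
  have key : ∀ (k : Irr C) (a : Fin (D.card k z)),
      D.spaceStar x y (tubeOf x y k (D.onb k z a ▷ x.obj ≫ γ ≫ y.obj ◁ adj (D.onb k z a))) =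
        D.psi y x z' (turn z z' (adj γ) ≫ x.obj ◁ dualMap z z' z'
          (adj (D.onb k z a) ≫ D.onb k z a)) := by
    intro k a
    rw [spaceStar_tubeOf, adj_comp, adj_comp, adj_whiskerLeft, adj_adj, adj_whiskerRight,
      Category.assoc, turn_conj (z' := z'), ← D.psi_simple rigid h1, D.psi_cyclic rigid h1, Category.assoc,
      ← whiskerLeft_comp, dualMap_comp]
  rw [psi_apply]
  simp only [map_sum, key]
  simp only [← map_sum, ← Preadditive.comp_sum, ← whiskerLeft_sum, ← dualMap_sum]
  rw [D.sum_adj_comp_onb rigid h1, dualMap_id, whiskerLeft_id, Category.comp_id]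

theorem spaceStar_spaceStar (rigid : IsRigid C) (h1 : IsSimple (𝟙_ C)) {x y : Irr C}
    (a : TubeSpace x y) : D.spaceStar y x (D.spaceStar x y a) = a := by
  induction a using tube_induction with
  | h0 => simp
  | hadd a a' ha ha' => simp only [map_add, ha, ha']
  | hof w γ =>
  let _ := (D.sol w).swap.exactPairing
  rw [spaceStar_tubeOf, ← D.psi_simple rigid h1,
    D.spaceStar_psi rigid h1 (z := (D.conj w).obj) (z' := w.obj), ← D.psi_simple rigid h1]
  congr 1
  exact (D.sol w).turn_turn γ

theorem spaceStar_spaceMul (rigid : IsRigid C) (h1 : IsSimple (𝟙_ C)) {x s y : Irr C}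
    (a : TubeSpace s y) (b : TubeSpace x s) :
    D.spaceStar x y (D.spaceMul x s y a b) =
      D.spaceMul y s x (D.spaceStar x s b) (D.spaceStar s y a) := by
  induction a using tube_induction with
  | h0 => simp
  | hadd a a' ha ha' => simp only [map_add, LinearMap.add_apply, ha, ha']
  | hof m γ₁ =>
  induction b using tube_induction with
  | h0 => simp
  | hadd b b' hb hb' => simp only [map_add, LinearMap.add_apply, hb, hb']
  | hof l γ₂ =>
  let _ := (D.sol m).exactPairing
  let _ := (D.sol l).exactPairing
  rw [spaceMul_tubeOf, spaceStar_tubeOf, spaceStar_tubeOf, spaceMul_tubeOf,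
    D.spaceStar_psi rigid h1 (z' := (D.conj l).obj ⊗ (D.conj m).obj), adj_tubeComp,
    turn_tubeComp]

theorem spaceStar_smul (x y : Irr C) (c : ℂ) (a : TubeSpace x y) :
    D.spaceStar x y (c • a) = star c • D.spaceStar x y a := by
  induction a using tube_induction with
  | h0 => simp
  | hadd a a' ha ha' => simp only [smul_add, map_add, ha, ha']
  | hof w γ =>
  rw [← map_smul, spaceStar_tubeOf, spaceStar_tubeOf, ← map_smul, adj_smul]
  congr 1
  simp [turn]

/-! ### The corners of the tube algebra -/

theorem incl_mul (x s y : Irr C) (a : TubeSpace s y) (b : TubeSpace x s) :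
    D.incl s y a * D.incl x s b = D.incl x y (D.spaceMul x s y a b) := by
  change D.sumMul (sumIncl s y a) (sumIncl x s b) = sumIncl x y (D.spaceMul x s y a b)
  simp only [sumMul, sumIncl, DirectSum.toModule_lof, LinearMap.flip_apply]
  rw [sumMulAux, dif_pos rfl]
  rfl

theorem star_incl (x y : Irr C) (a : TubeSpace x y) :
    star (D.incl x y a) = D.incl y x (D.spaceStar x y a) := by
  change D.sumStar (sumIncl x y a) = sumIncl y x (D.spaceStar x y a)
  unfold sumStar
  exact DirectSum.toAddMonoid_of _ _ _

theorem tube_add_mul (a b c : D.Tube) : (a + b) * c = a * c + b * c :=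
  congrArg (fun f => f c) (D.sumMul.map_add a b)

theorem tube_mul_add (a b c : D.Tube) : a * (b + c) = a * b + a * c :=
  (D.sumMul a).map_add b c

theorem tube_smul_mul (t : ℂ) (a b : D.Tube) : (t • a) * b = t • (a * b) :=
  congrArg (fun f => f b) (D.sumMul.map_smul t a)

theorem tube_mul_smul (t : ℂ) (a b : D.Tube) : a * (t • b) = t • (a * b) :=
  (D.sumMul a).map_smul t b

theorem tube_star_add (a b : D.Tube) : star (a + b) = star a + star b :=
  D.sumStar.map_add a b

theorem tube_sum_mul {ι : Type*} (s : Finset ι) (f : ι → D.Tube) (b : D.Tube) :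
    (∑ i ∈ s, f i) * b = ∑ i ∈ s, f i * b :=
  map_sum (AddMonoidHom.mk' (fun a : D.Tube => a * b) fun _ _ => D.tube_add_mul _ _ _) f s

theorem tube_mul_sum {ι : Type*} (s : Finset ι) (f : ι → D.Tube) (a : D.Tube) :
    a * (∑ i ∈ s, f i) = ∑ i ∈ s, a * f i :=
  map_sum (AddMonoidHom.mk' (fun b : D.Tube => a * b) fun _ _ => D.tube_mul_add _ _ _) f s

theorem tube_star_sum {ι : Type*} (s : Finset ι) (f : ι → D.Tube) :
    star (∑ i ∈ s, f i) = ∑ i ∈ s, star (f i) :=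
  map_sum (AddMonoidHom.mk' (fun b : D.Tube => star b) D.tube_star_add) f s

variable {D}

theorem mul_mem_corner {x s y : Irr C} {a b : D.Tube} (ha : a ∈ D.corner s y)
    (hb : b ∈ D.corner x s) : a * b ∈ D.corner x y := by
  obtain ⟨a, rfl⟩ := ha
  obtain ⟨b, rfl⟩ := hb
  exact ⟨_, (D.incl_mul x s y a b).symm⟩

theorem star_mem_corner {x y : Irr C} {a : D.Tube} (ha : a ∈ D.corner x y) :
    star a ∈ D.corner y x := by
  obtain ⟨a, rfl⟩ := ha
  exact ⟨_, (D.star_incl x y a).symm⟩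

theorem corner_mul_assoc (rigid : IsRigid C) (h1 : IsSimple (𝟙_ C)) {x s t y : Irr C}
    {a b c : D.Tube} (ha : a ∈ D.corner t y) (hb : b ∈ D.corner s t) (hc : c ∈ D.corner x s) :
    a * b * c = a * (b * c) := by
  obtain ⟨a, rfl⟩ := ha
  obtain ⟨b, rfl⟩ := hb
  obtain ⟨c, rfl⟩ := hc
  simp only [incl_mul, D.spaceMul_assoc rigid h1]

theorem proj_mul (rigid : IsRigid C) (h1 : IsSimple (𝟙_ C)) {x y : Irr C} {a : D.Tube}
    (ha : a ∈ D.corner x y) : D.proj y * a = a := by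
  obtain ⟨a, rfl⟩ := ha
  rw [proj, incl_mul, D.one_spaceMul rigid h1]

theorem mul_proj (rigid : IsRigid C) (h1 : IsSimple (𝟙_ C)) {x y : Irr C} {a : D.Tube}
    (ha : a ∈ D.corner x y) : a * D.proj x = a := by
  obtain ⟨a, rfl⟩ := ha
  rw [proj, incl_mul, D.spaceMul_one rigid h1]

theorem corner_star_star (rigid : IsRigid C) (h1 : IsSimple (𝟙_ C)) {x y : Irr C} {a : D.Tube}
    (ha : a ∈ D.corner x y) : star (star a) = a := by
  obtain ⟨a, rfl⟩ := ha
  rw [star_incl, star_incl, D.spaceStar_spaceStar rigid h1]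

theorem corner_star_mul (rigid : IsRigid C) (h1 : IsSimple (𝟙_ C)) {x s y : Irr C}
    {a b : D.Tube} (ha : a ∈ D.corner s y) (hb : b ∈ D.corner x s) :
    star (a * b) = star b * star a := by
  obtain ⟨a, rfl⟩ := ha
  obtain ⟨b, rfl⟩ := hb
  rw [incl_mul, star_incl, star_incl, star_incl, incl_mul, D.spaceStar_spaceMul rigid h1]

theorem corner_star_smul {x y : Irr C} (c : ℂ) {a : D.Tube} (ha : a ∈ D.corner x y) :
    star (c • a) = star c • star a := by
  obtain ⟨a, rfl⟩ := ha
  rw [← map_smul, star_incl, star_incl, spaceStar_smul, map_smul]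

end TubeChoices

end

/-! ### Bounded elements of a `*`-algebra -/

section

variable {A : Type*} [AddCommGroup A] [Module ℂ A] [Mul A] [One A] [Star A] {P : Set A}

theorem IsStarPositiveCone.star_mul_self_mem (hA : IsUnitalStarAlgebra A)
    (hP : IsStarPositiveCone P) (x : A) : star x * x ∈ P := by
  have h := hP.conj_mem _ (hP.smul_one_mem 1 zero_le_one) x
  rwa [hA.mul_smul, hA.mul_one, hA.smul_mul, Complex.ofReal_one, one_smul] at h

theorem IsStarPositiveCone.zero_mem (hP : IsStarPositiveCone P) : (0 : A) ∈ P := by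
  simpa using hP.smul_one_mem 0 le_rfl

theorem IsStarPositiveCone.add_mem (hP : IsStarPositiveCone P) {a b : A} (ha : a ∈ P)
    (hb : b ∈ P) : a + b ∈ P := by
  simpa using hP.smul_add_mem 1 zero_le_one a ha b hb

theorem IsStarPositiveCone.smul_mem (hP : IsStarPositiveCone P) {r : ℝ} (hr : 0 ≤ r) {a : A}
    (ha : a ∈ P) : (r : ℂ) • a ∈ P := by
  simpa using hP.smul_add_mem r hr a ha 0 hP.zero_mem

/-- Boundedness of a sum, from the parallelogram law
`2 x* x + 2 y* y - (x + y)* (x + y) = (x - y)* (x - y)`. -/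
theorem add_mem_boundedElements (hA : IsUnitalStarAlgebra A) (hP : IsStarPositiveCone P) {x y : A}
    (hx : x ∈ boundedElements P) (hy : y ∈ boundedElements P) : x + y ∈ boundedElements P := by
  obtain ⟨R, hR, hxR⟩ := hx
  obtain ⟨S, hS, hyS⟩ := hy
  refine ⟨2 * R + 2 * S, by positivity, ?_⟩
  have h := hP.add_mem (hP.add_mem (hP.smul_mem zero_le_two hxR) (hP.smul_mem zero_le_two hyS))
    (hP.star_mul_self_mem hA (x + (-1 : ℂ) • y))
  convert h using 1
  have hs : star (-1 : ℂ) = -1 := by simp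
  rw [hA.star_add, hA.star_add, hA.star_smul, hs]
  simp only [hA.add_mul, hA.mul_add, hA.smul_mul, hA.mul_smul]
  push_cast
  module

theorem smul_mem_boundedElements (hA : IsUnitalStarAlgebra A) (hP : IsStarPositiveCone P) {x : A}
    (t : ℂ) (hx : x ∈ boundedElements P) : t • x ∈ boundedElements P := by
  obtain ⟨R, hR, hxR⟩ := hx
  have hn : 0 ≤ Complex.normSq t := Complex.normSq_nonneg t
  refine ⟨Complex.normSq t * R + 1, by positivity, ?_⟩
  have h := hP.add_mem (hP.smul_mem hn hxR) (hP.smul_one_mem 1 zero_le_one)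
  convert h using 1
  have h2 : star t * t = (Complex.normSq t : ℂ) := (Complex.normSq_eq_conj_mul_self).symm
  rw [hA.star_smul, hA.smul_mul, hA.mul_smul, smul_smul, h2]
  push_cast
  module

end

section

variable {C : Type u} [Category.{v} C] [Preadditive C] [Linear ℂ C]
  [MonoidalCategory C] [MonoidalPreadditive C] [MonoidalLinear ℂ C] [CStarTensorCategory C]

open CStarCategory CStarTensorCategory

namespace TubeChoices

variable (D : TubeChoices C)

/-! ### The fusion algebra as a corner of the tube algebra -/

/-- The element `Ψ^z (1_z)` of the corner `A_{𝟙,𝟙}`. -/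
noncomputable def idTube (z : C) : D.Tube :=
  D.incl .one .one (D.psi .one .one z ((ρ_ z).hom ≫ (λ_ z).inv))

theorem idTube_mem_corner (z : C) : D.idTube z ∈ D.corner .one .one := ⟨_, rfl⟩

theorem idTube_simple (rigid : IsRigid C) (h1 : IsSimple (𝟙_ C)) (w : Irr C) :
    D.idTube w.obj = D.incl .one .one (tubeOf .one .one w ((ρ_ w.obj).hom ≫ (λ_ w.obj).inv)) := by
  rw [idTube]
  congr 1
  exact D.psi_simple rigid h1 _ _ _ _

theorem idTube_mul (rigid : IsRigid C) (h1 : IsSimple (𝟙_ C)) (z z' : C) :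
    D.idTube z * D.idTube z' = D.idTube (z ⊗ z') := by
  rw [idTube, idTube, incl_mul, D.spaceMul_psi rigid h1, idTube]
  congr 2
  simp only [tubeComp, Irr.obj]
  monoidal

theorem star_idTube (rigid : IsRigid C) (h1 : IsSimple (𝟙_ C)) (w : Irr C) :
    star (D.idTube w.obj) = D.idTube (D.conj w).obj := by
  let _ := (D.sol w).exactPairing
  rw [idTube, star_incl, D.spaceStar_psi rigid h1 _ _ (z' := (D.conj w).obj), idTube]
  congr 2
  have e : adj ((ρ_ w.obj).hom ≫ (λ_ w.obj).inv) = (λ_ w.obj).hom ≫ (ρ_ w.obj).inv := by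
    rw [adj_comp, adj_leftUnitor_inv, adj_rightUnitor]
  exact (congrArg (turn w.obj (D.conj w).obj) e).trans turn_id

theorem finrank_hom (h1 : IsSimple (𝟙_ C)) (k : Irr C) (z : C) :
    Module.finrank ℂ (k.obj ⟶ z) = D.card k z := by
  have hli : LinearIndependent ℂ (D.onb k z) := by
    rw [Fintype.linearIndependent_iff]
    intro g hg i
    have h := congrArg (fun f => f ≫ adj (D.onb k z i)) hg
    simp only [Preadditive.sum_comp, Linear.smul_comp, D.onb_orthonormal, Limits.zero_comp] at h
    simp only [smul_ite, smul_zero, Finset.sum_ite_eq', Finset.mem_univ, if_true] at h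
    exact (smul_eq_zero.1 h).resolve_right (k.isSimple_obj h1).id_ne_zero
  have b := Module.Basis.mk hli (D.onb_span k z).ge
  rw [Module.finrank_eq_card_basis b, Fintype.card_fin]

theorem idTube_eq_sum (rigid : IsRigid C) (h1 : IsSimple (𝟙_ C)) (z : C) :
    D.idTube z = ∑ k ∈ D.supp z, (Module.finrank ℂ (k.obj ⟶ z) : ℂ) • D.idTube k.obj := by
  have key : ∀ (k : Irr C) (a : Fin (D.card k z)),
      D.onb k z a ▷ (𝟙_ C) ≫ ((ρ_ z).hom ≫ (λ_ z).inv) ≫ 𝟙_ C ◁ adj (D.onb k z a) =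
        (ρ_ k.obj).hom ≫ (λ_ k.obj).inv := by
    intro k a
    calc
      _ = (ρ_ k.obj).hom ≫ (D.onb k z a ≫ adj (D.onb k z a)) ≫ (λ_ k.obj).inv := by monoidal
      _ = _ := by rw [D.onb_orthonormal, if_pos rfl, Category.id_comp]
  simp only [D.idTube_simple rigid h1, D.finrank_hom h1]
  rw [idTube, psi_apply]
  simp only [map_sum]
  refine Finset.sum_congr rfl fun k _ => ?_
  refine (Finset.sum_congr rfl fun a _ =>
    congrArg (fun t => D.incl .one .one (tubeOf .one .one k t)) (key k a)).trans ?_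
  rw [Finset.sum_const, Finset.card_univ, Fintype.card_fin, Nat.cast_smul_eq_nsmul]
  rfl

theorem fusionToTube_apply (a : D.FusionAlgebra) :
    D.fusionToTube a = Finsupp.sum (M := ℂ) a fun w s => s • D.idTube w.obj :=
  Finsupp.linearCombination_apply ℂ _

theorem fusionToTube_basis (w : Irr C) : D.fusionToTube (D.basis w) = D.idTube w.obj := by
  have h := Finsupp.linearCombination_single ℂ (v := fun w : Irr C => D.idTube w.obj) 1 w
  rw [one_smul] at h
  exact h

theorem fusionToTube_mem_corner (a : D.FusionAlgebra) :
    D.fusionToTube a ∈ D.corner .one .one := by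
  rw [fusionToTube_apply]
  exact Submodule.sum_mem _ fun w _ => Submodule.smul_mem _ _ (D.idTube_mem_corner w.obj)

theorem fusionToTube_injective (rigid : IsRigid C) (h1 : IsSimple (𝟙_ C)) :
    Function.Injective D.fusionToTube := by
  classical
  rw [← LinearMap.ker_eq_bot, LinearMap.ker_eq_bot']
  intro a ha
  rw [fusionToTube_apply] at ha
  simp only [D.idTube_simple rigid h1, Finsupp.sum, ← map_smul, ← map_sum] at ha
  have hinj : Function.Injective (D.incl .one .one) :=
    DirectSum.of_injective (β := fun p : Irr C × Irr C => TubeSpace p.1 p.2) (.one, .one)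
  have h0 := hinj (ha.trans (map_zero _).symm)
  refine Finsupp.ext (M := ℂ) fun w => ?_
  by_contra hw
  have hw' : w ∈ Finsupp.support (M := ℂ) a := Finsupp.mem_support_iff.2 hw
  have h2 := congrArg (DirectSum.component ℂ (Irr C) _ w) h0
  rw [map_sum, Finset.sum_eq_single w, DirectSum.component.lof_self, map_zero] at h2
  · have h3 : (ρ_ w.obj).hom ≫ (λ_ w.obj).inv = 0 := (smul_eq_zero.1 h2).resolve_left hw
    have h4 : (ρ_ w.obj).inv ≫ ((ρ_ w.obj).hom ≫ (λ_ w.obj).inv) ≫ (λ_ w.obj).hom = 0 := by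
      rw [h3]
      simp
    simp only [Category.assoc, Iso.inv_hom_id, Category.comp_id] at h4
    exact (w.isSimple_obj h1).id_ne_zero h4
  · intro x _ hx
    rw [DirectSum.component.of, dif_neg hx]
  · intro h
    exact absurd hw' h

omit [MonoidalPreadditive C] [MonoidalLinear ℂ C] [CStarTensorCategory C] in
theorem exists_smul_id (h1 : IsSimple (𝟙_ C)) (w : Irr C) (γ : w.obj ⊗ 𝟙_ C ⟶ 𝟙_ C ⊗ w.obj) :
    ∃ c : ℂ, γ = c • ((ρ_ w.obj).hom ≫ (λ_ w.obj).inv) := by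
  obtain ⟨c, hc⟩ := (w.isSimple_obj h1).exists_smul ((ρ_ w.obj).inv ≫ γ ≫ (λ_ w.obj).hom)
  refine ⟨c, ?_⟩
  calc
    γ = (ρ_ w.obj).hom ≫ ((ρ_ w.obj).inv ≫ γ ≫ (λ_ w.obj).hom) ≫ (λ_ w.obj).inv := by simp
    _ = _ := by
      rw [hc]
      simp

theorem range_fusionToTube (rigid : IsRigid C) (h1 : IsSimple (𝟙_ C)) :
    LinearMap.range D.fusionToTube = D.corner .one .one := by
  apply le_antisymm
  · rintro _ ⟨a, rfl⟩
    exact D.fusionToTube_mem_corner a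
  · rintro _ ⟨a, rfl⟩
    induction a using tube_induction with
    | h0 => simp
    | hadd a a' ha ha' =>
      rw [map_add]
      exact Submodule.add_mem _ ha ha'
    | hof w γ =>
      obtain ⟨c, hc⟩ := exists_smul_id h1 w γ
      refine ⟨c • D.basis w, ?_⟩
      rw [map_smul, fusionToTube_basis, D.idTube_simple rigid h1, ← map_smul, ← map_smul]
      exact congrArg (fun t => D.incl .one .one (tubeOf .one .one w t)) hc.symm

theorem fusionToTube_one (rigid : IsRigid C) (h1 : IsSimple (𝟙_ C)) :
    D.fusionToTube 1 = D.proj .one := by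
  have h := (D.fusionToTube_basis .one).trans (D.idTube_simple rigid h1 .one)
  refine h.trans ?_
  rw [proj]
  congr 2
  simp only [Irr.obj]
  monoidal

theorem fusionToTube_mul (rigid : IsRigid C) (h1 : IsSimple (𝟙_ C)) (a b : D.FusionAlgebra) :
    D.fusionToTube (a * b) = D.fusionToTube a * D.fusionToTube b := by
  have hab : a * b = ∑ x ∈ Finsupp.support (M := ℂ) a, ∑ y ∈ Finsupp.support (M := ℂ) b,
      (DFunLike.coe (F := Irr C →₀ ℂ) a x * DFunLike.coe (F := Irr C →₀ ℂ) b y) •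
        ∑ z ∈ D.supp (x.obj ⊗ y.obj),
        (Module.finrank ℂ (z.obj ⟶ x.obj ⊗ y.obj) : ℂ) • D.basis z := rfl
  rw [hab, D.fusionToTube_apply a, D.fusionToTube_apply b]
  simp only [map_sum, map_smul, fusionToTube_basis, ← D.idTube_eq_sum rigid h1]
  simp only [Finsupp.sum, tube_sum_mul, tube_smul_mul]
  refine Finset.sum_congr rfl fun x _ => ?_
  rw [tube_mul_sum, Finset.smul_sum]
  refine Finset.sum_congr rfl fun y _ => ?_
  rw [tube_mul_smul, D.idTube_mul rigid h1, smul_smul]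

theorem fusionToTube_star (rigid : IsRigid C) (h1 : IsSimple (𝟙_ C)) (a : D.FusionAlgebra) :
    D.fusionToTube (star a) = star (D.fusionToTube a) := by
  have ha : star a = ∑ x ∈ Finsupp.support (M := ℂ) a,
      star (DFunLike.coe (F := Irr C →₀ ℂ) a x) • D.basis (D.conj x) := rfl
  rw [ha, D.fusionToTube_apply a, map_sum]
  unfold Finsupp.sum
  rw [tube_star_sum]
  refine Finset.sum_congr rfl fun x _ => ?_
  rw [map_smul, fusionToTube_basis, corner_star_smul _ (D.idTube_mem_corner _),
    D.star_idTube rigid h1]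

theorem fusion_isUnitalStarAlgebra (rigid : IsRigid C) (h1 : IsSimple (𝟙_ C)) :
    IsUnitalStarAlgebra D.FusionAlgebra := by
  have hinj := D.fusionToTube_injective rigid h1
  have hmem := D.fusionToTube_mem_corner
  have hmul := D.fusionToTube_mul rigid h1
  have hone := D.fusionToTube_one rigid h1
  have hstar := D.fusionToTube_star rigid h1
  constructor
  · intro a b c
    apply hinj
    simp only [hmul, corner_mul_assoc rigid h1 (hmem a) (hmem b) (hmem c)]
  · intro a
    apply hinj
    rw [hmul, hone, proj_mul rigid h1 (hmem a)]
  · intro a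
    apply hinj
    rw [hmul, hone, mul_proj rigid h1 (hmem a)]
  · intro a b c
    apply hinj
    simp only [hmul, map_add, tube_add_mul]
  · intro a b c
    apply hinj
    simp only [hmul, map_add, tube_mul_add]
  · intro t a b
    apply hinj
    simp only [hmul, map_smul, tube_smul_mul]
  · intro t a b
    apply hinj
    simp only [hmul, map_smul, tube_mul_smul]
  · intro a
    apply hinj
    simp only [hstar, corner_star_star rigid h1 (hmem a)]
  · intro a b
    apply hinj
    simp only [hstar, map_add, tube_star_add]
  · intro t a
    apply hinj
    simp only [hstar, map_smul, corner_star_smul t (hmem a)]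
  · intro a b
    apply hinj
    simp only [hstar, hmul, corner_star_mul rigid h1 (hmem a) (hmem b)]

/-! ### The tube cone -/

theorem tubeCone_zero_mem : (0 : D.Tube) ∈ D.tubeCone :=
  ⟨0, Fin.elim0, Fin.elim0, fun i => i.elim0, by simp⟩

variable {D}

theorem mul_star_mem_tubeCone {x : Irr C} {a : D.Tube} (ha : a ∈ D.corner x .one) :
    a * star a ∈ D.tubeCone :=
  ⟨1, fun _ => x, fun _ => a, fun _ => ha, by simp⟩

theorem tubeCone_add_mem {a b : D.Tube} (ha : a ∈ D.tubeCone) (hb : b ∈ D.tubeCone) :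
    a + b ∈ D.tubeCone := by
  obtain ⟨m, x, f, hf, rfl⟩ := ha
  obtain ⟨n, y, g, hg, rfl⟩ := hb
  refine ⟨m + n, Fin.append x y, Fin.append f g, fun i => ?_, ?_⟩
  · induction i using Fin.addCases with
    | left i => simpa using hf i
    | right i => simpa using hg i
  · simp [Fin.sum_univ_add]

theorem tubeCone_sum_mem {ι : Type*} (s : Finset ι) (f : ι → D.Tube)
    (hf : ∀ i ∈ s, f i ∈ D.tubeCone) : ∑ i ∈ s, f i ∈ D.tubeCone :=
  Finset.sum_induction f (· ∈ D.tubeCone) (fun _ _ => tubeCone_add_mem) D.tubeCone_zero_mem hf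

theorem smul_mul_star_smul {x y : Irr C} {a : D.Tube} (ha : a ∈ D.corner x y) (c : ℂ) :
    (c • a) * star (c • a) = (Complex.normSq c : ℂ) • (a * star a) := by
  rw [corner_star_smul c ha, tube_smul_mul, tube_mul_smul, smul_smul,
    Complex.normSq_eq_conj_mul_self, mul_comm]
  rfl

theorem tubeCone_smul_mem {r : ℝ} (hr : 0 ≤ r) {a : D.Tube} (ha : a ∈ D.tubeCone) :
    (r : ℂ) • a ∈ D.tubeCone := by
  obtain ⟨m, x, f, hf, rfl⟩ := ha
  refine ⟨m, x, fun i => ((Real.sqrt r : ℝ) : ℂ) • f i,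
    fun i => Submodule.smul_mem _ _ (hf i), ?_⟩
  rw [Finset.smul_sum]
  refine Finset.sum_congr rfl fun i _ => ?_
  rw [smul_mul_star_smul (hf i), Complex.normSq_ofReal, Real.mul_self_sqrt hr]

theorem tubeCone_conj_mem (rigid : IsRigid C) (h1 : IsSimple (𝟙_ C)) {a t : D.Tube}
    (ha : a ∈ D.tubeCone) (ht : t ∈ D.corner .one .one) : star t * a * t ∈ D.tubeCone := by
  obtain ⟨m, x, f, hf, rfl⟩ := ha
  have ht' := star_mem_corner ht
  refine ⟨m, x, fun i => star t * f i, fun i => mul_mem_corner ht' (hf i), ?_⟩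
  rw [tube_mul_sum, tube_sum_mul]
  refine Finset.sum_congr rfl fun i _ => ?_
  have hs := star_mem_corner (hf i)
  rw [corner_star_mul rigid h1 ht' (hf i), corner_star_star rigid h1 ht,
    ← corner_mul_assoc rigid h1 ht' (hf i) hs,
    corner_mul_assoc rigid h1 (mul_mem_corner ht' (hf i)) hs ht]

theorem tubeCone_star_eq (rigid : IsRigid C) (h1 : IsSimple (𝟙_ C)) {a : D.Tube}
    (ha : a ∈ D.tubeCone) : star a = a := by
  obtain ⟨m, x, f, hf, rfl⟩ := ha
  rw [tube_star_sum]
  refine Finset.sum_congr rfl fun i _ => ?_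
  rw [corner_star_mul rigid h1 (hf i) (star_mem_corner (hf i)),
    corner_star_star rigid h1 (hf i)]

variable (D)

theorem tubeCone_subset_corner : D.tubeCone ⊆ D.corner .one .one := by
  rintro _ ⟨m, x, f, hf, rfl⟩
  exact Submodule.sum_mem _ fun i _ => mul_mem_corner (hf i) (star_mem_corner (hf i))

theorem fusionCone_isStarPositiveCone (rigid : IsRigid C) (h1 : IsSimple (𝟙_ C)) :
    IsStarPositiveCone D.fusionCone := by
  constructor
  · intro a ha
    apply D.fusionToTube_injective rigid h1
    rw [D.fusionToTube_star rigid h1, tubeCone_star_eq rigid h1 ha]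
  · intro r hr
    change D.fusionToTube _ ∈ D.tubeCone
    rw [map_smul, D.fusionToTube_one rigid h1]
    have hp : D.proj .one ∈ D.corner .one .one := ⟨_, rfl⟩
    have h := mul_star_mem_tubeCone hp
    rw [proj_mul rigid h1 (star_mem_corner hp)] at h
    rw [← tubeCone_star_eq rigid h1 h, corner_star_star rigid h1 hp] at h
    exact tubeCone_smul_mem hr h
  · intro r hr a ha b hb
    change D.fusionToTube _ ∈ D.tubeCone
    rw [map_add, map_smul]
    exact tubeCone_add_mem (tubeCone_smul_mem hr ha) hb
  · intro a ha x
    change D.fusionToTube _ ∈ D.tubeCone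
    rw [D.fusionToTube_mul rigid h1, D.fusionToTube_mul rigid h1, D.fusionToTube_star rigid h1]
    exact tubeCone_conj_mem rigid h1 ha (D.fusionToTube_mem_corner x)

/-! ### Boundedness of the simple objects -/

/-- The morphism `(Rbar* ⊗ 1_k) (1_k ⊗ f) : k ⊗ x ⟶ 𝟙 ⊗ k` obtained from `f : x ⟶ kbar ⊗ k`. -/
noncomputable def bend (k x : Irr C) :
    (x.obj ⟶ (D.conj k).obj ⊗ k.obj) →ₗ[ℂ] (k.obj ⊗ x.obj ⟶ Irr.one.obj ⊗ k.obj) where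
  toFun f := k.obj ◁ f ≫ (α_ k.obj (D.conj k).obj k.obj).inv ≫ adj (D.sol k).Rbar ▷ k.obj
  map_add' _ _ := by simp
  map_smul' _ _ := by simp

/-- `ConjugateSolution.quarterTurn` for the chosen solution of a simple object, with the unit object
written as the representative of its class. -/
noncomputable def quarterTurn (k : Irr C) :
    ((D.conj k).obj ⊗ k.obj ⟶ (D.conj k).obj ⊗ k.obj) →ₗ[ℂ]
      ((k.obj ⊗ (D.conj k).obj) ⊗ Irr.one.obj ⟶ Irr.one.obj ⊗ (k.obj ⊗ (D.conj k).obj)) :=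
  (D.sol k).quarterTurn

/-- The product `a a*` for `a` given by a bent morphism `f` is the rotation of `f f*`. -/
theorem bend_mul_star (rigid : IsRigid C) (h1 : IsSimple (𝟙_ C)) (k x : Irr C)
    (f : x.obj ⟶ (D.conj k).obj ⊗ k.obj) :
    D.incl x .one (D.psi x .one k.obj (D.bend k x f)) *
        star (D.incl x .one (D.psi x .one k.obj (D.bend k x f))) =
      D.incl .one .one (D.psi .one .one (k.obj ⊗ (D.conj k).obj)
        (D.quarterTurn k (adj f ≫ f))) := by
  let _ := (D.sol k).exactPairing
  rw [star_incl, D.spaceStar_psi rigid h1 _ _ (z' := (D.conj k).obj), incl_mul,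
    D.spaceMul_psi rigid h1]
  congr 2
  have e : turn k.obj (D.conj k).obj (adj (D.bend k x f)) =
      (D.conj k).obj ◁ (D.sol k).Rbar ≫ (α_ (D.conj k).obj k.obj (D.conj k).obj).inv ≫
        adj f ▷ (D.conj k).obj := by
    have h := turn_coev (z := k.obj) (z' := (D.conj k).obj) (adj f)
    refine Eq.trans ?_ h
    congr 1
    change adj (k.obj ◁ f ≫ (α_ k.obj (D.conj k).obj k.obj).inv ≫
      adj (D.sol k).Rbar ▷ k.obj) = (D.sol k).Rbar ▷ k.obj ≫ _
    simp only [adj_comp, adj_whiskerLeft, adj_associator_inv, adj_whiskerRight, adj_adj,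
      Category.assoc]
  rw [e]
  change tubeComp (k.obj ◁ f ≫ (α_ k.obj (D.conj k).obj k.obj).inv ≫
      adj (D.sol k).Rbar ▷ k.obj) _ = (α_ k.obj (D.conj k).obj (𝟙_ C)).hom ≫ _
  simp only [tubeComp, Irr.obj]
  monoidal

/-- For a simple object `k`, the products `a a*` over all bent basis elements of the spaces
`C(x, kbar ⊗ k)` sum up to the scalar `Rbar* Rbar`. -/
theorem sum_bend_mul_star (rigid : IsRigid C) (h1 : IsSimple (𝟙_ C)) (k : Irr C) :
    ∃ d : ℝ, 0 < d ∧ ∑ x ∈ D.supp ((D.conj k).obj ⊗ k.obj), ∑ b,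
      D.incl x .one (D.psi x .one k.obj (D.bend k x (D.onb x _ b))) *
        star (D.incl x .one (D.psi x .one k.obj (D.bend k x (D.onb x _ b)))) =
      (d : ℂ) • D.proj .one := by
  obtain ⟨d, hd, hdR⟩ := h1.exists_pos
    ((D.sol k).Rbar_ne_zero (k.isSimple_obj h1).id_ne_zero)
  refine ⟨d, hd, ?_⟩
  simp only [D.bend_mul_star rigid h1]
  simp only [← map_sum]
  rw [D.sum_adj_comp_onb rigid h1]
  have h := D.psi_cyclic rigid h1 .one .one (adj (D.sol k).Rbar) (𝟙_ C ◁ (D.sol k).Rbar)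
  have e2 : 𝟙_ C ◁ (D.sol k).Rbar ≫ 𝟙_ C ◁ adj (D.sol k).Rbar = (d : ℂ) • 𝟙 (𝟙_ C ⊗ 𝟙_ C) := by
    rw [← whiskerLeft_comp, hdR, MonoidalLinear.whiskerLeft_smul, whiskerLeft_id]
  refine (congrArg (fun t => D.incl .one .one (D.psi .one .one _ t)) (D.sol k).quarterTurn_id).trans ?_
  refine (congrArg (D.incl .one .one) h).trans ?_
  refine (congrArg (fun t => D.incl .one .one (D.psi .one .one (𝟙_ C) t)) e2).trans ?_
  have e3 : 𝟙 (𝟙_ C ⊗ 𝟙_ C) = (λ_ (𝟙_ C)).hom ≫ (ρ_ (𝟙_ C)).inv := by monoidal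
  rw [e3]
  have h5 := D.psi_simple rigid h1 .one .one .one ((d : ℂ) • ((λ_ (𝟙_ C)).hom ≫ (ρ_ (𝟙_ C)).inv))
  refine (congrArg (D.incl .one .one) h5).trans ?_
  have h6 := (tubeOf (C := C) .one .one .one).map_smul (d : ℂ)
    ((λ_ (𝟙_ C)).hom ≫ (ρ_ (𝟙_ C)).inv)
  exact (congrArg (D.incl .one .one) h6).trans ((D.incl .one .one).map_smul _ _)

/-- Some element of the basis of `C(𝟙, kbar ⊗ k)` has a nonzero bending, because the bending of `R` is
the identity of `k` by the conjugate equations. -/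
theorem exists_bend_ne_zero (h1 : IsSimple (𝟙_ C)) (k : Irr C) :
    ∃ b, D.bend k .one (D.onb .one _ b) ≠ 0 := by
  by_contra hcon
  push Not at hcon
  have hzero : D.bend k .one = 0 := by
    apply LinearMap.ext_on_range (v := D.onb .one ((D.conj k).obj ⊗ k.obj)) (D.onb_span _ _)
    intro b
    exact hcon b
  have h := congrArg (fun L => L (D.sol k).R) hzero
  have h2 : k.obj ◁ (D.sol k).R ≫ (α_ k.obj (D.conj k).obj k.obj).inv ≫
      adj (D.sol k).Rbar ▷ k.obj = 0 := h
  have h3 := (D.sol k).eq_of_R_comp (𝟙 k.obj)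
  rw [whiskerLeft_id, Category.comp_id, reassoc_of% h2] at h3
  apply (k.isSimple_obj h1).id_ne_zero
  rw [← h3]
  simp

/-- Boundedness of a simple object `k`: in the decomposition of the scalar `Rbar* Rbar` as a sum of
products `a a*`, the summands with `a ∈ A_{𝟙,𝟙}` are multiples of `k k*`. -/
theorem exists_bound_idTube (rigid : IsRigid C) (h1 : IsSimple (𝟙_ C)) (k : Irr C) :
    ∃ r : ℝ, 0 < r ∧
      (r : ℂ) • D.proj .one - D.idTube k.obj * star (D.idTube k.obj) ∈ D.tubeCone := by
  classical
  obtain ⟨d, hd, hsum⟩ := D.sum_bend_mul_star rigid h1 k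
  choose c hc using fun b => exists_smul_id h1 k (D.bend k .one (D.onb .one _ b))
  have hterm : ∀ b, D.incl .one .one (D.psi .one .one k.obj (D.bend k .one (D.onb .one _ b))) =
      c b • D.idTube k.obj := by
    intro b
    rw [idTube, ← map_smul, ← map_smul]
    exact congrArg (fun t => D.incl .one .one (D.psi .one .one k.obj t)) (hc b)
  obtain ⟨b₀, hb₀⟩ := D.exists_bend_ne_zero h1 k
  have hcb : c b₀ ≠ 0 := by
    intro h
    apply hb₀
    refine (hc b₀).trans ?_
    rw [h, zero_smul]
    rfl
  have hmem : Irr.one ∈ D.supp ((D.conj k).obj ⊗ k.obj) := by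
    rw [mem_supp]
    intro h
    exact (Fin.cast h b₀).elim0
  set s : ℝ := ∑ b, Complex.normSq (c b) with hs
  have hs0 : 0 < s := Finset.sum_pos' (fun b _ => Complex.normSq_nonneg _)
    ⟨b₀, Finset.mem_univ _, Complex.normSq_pos.2 hcb⟩
  rw [← Finset.add_sum_erase _ _ hmem] at hsum
  have hone : ∑ b, D.incl .one .one (D.psi .one .one k.obj (D.bend k .one (D.onb .one _ b))) *
      star (D.incl .one .one (D.psi .one .one k.obj (D.bend k .one (D.onb .one _ b)))) =
      (s : ℂ) • (D.idTube k.obj * star (D.idTube k.obj)) := by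
    simp only [hterm, smul_mul_star_smul (D.idTube_mem_corner k.obj)]
    rw [← Finset.sum_smul, hs]
    push_cast
    rfl
  rw [hone] at hsum
  refine ⟨s⁻¹ * d, by positivity, ?_⟩
  have hs' : ((s⁻¹ : ℝ) : ℂ) * (s : ℂ) = 1 := by
    norm_cast
    exact inv_mul_cancel₀ hs0.ne'
  rw [Complex.ofReal_mul, mul_smul, ← hsum, smul_add, smul_smul, hs', one_smul,
    add_sub_cancel_left]
  refine tubeCone_smul_mem (inv_nonneg.2 hs0.le) ?_
  exact tubeCone_sum_mem _ _ fun x _ => tubeCone_sum_mem _ _ fun b _ =>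
    mul_star_mem_tubeCone ⟨_, rfl⟩

theorem basis_mem_boundedElements (rigid : IsRigid C) (h1 : IsSimple (𝟙_ C)) (w : Irr C) :
    D.basis w ∈ boundedElements D.fusionCone := by
  obtain ⟨r, hr, h⟩ := D.exists_bound_idTube rigid h1 (D.conj w)
  refine ⟨r, hr, ?_⟩
  change D.fusionToTube _ ∈ D.tubeCone
  rw [← D.star_idTube rigid h1, corner_star_star rigid h1 (D.idTube_mem_corner _)] at h
  rw [map_sub, map_smul, D.fusionToTube_one rigid h1, D.fusionToTube_mul rigid h1,
    D.fusionToTube_star rigid h1, fusionToTube_basis]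
  exact h

theorem boundedElements_fusionCone (rigid : IsRigid C) (h1 : IsSimple (𝟙_ C)) :
    boundedElements D.fusionCone = Set.univ := by
  have hA := D.fusion_isUnitalStarAlgebra rigid h1
  have hP := D.fusionCone_isStarPositiveCone rigid h1
  refine Set.eq_univ_of_forall fun a => ?_
  have hbasis := fun (w : Irr C) (t : ℂ) =>
    smul_mem_boundedElements hA hP t (D.basis_mem_boundedElements rigid h1 w)
  refine Finsupp.induction_linear (motive := fun a => (show D.FusionAlgebra from a) ∈
    boundedElements D.fusionCone) a ?_ ?_ ?_
  · have h := hbasis .one 0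
    rwa [zero_smul] at h
  · intro f g hf hg
    exact add_mem_boundedElements hA hP hf hg
  · intro w t
    have h := hbasis w t
    have e : t • D.basis w = Finsupp.single (M := ℂ) w t := by
      change t • Finsupp.single (M := ℂ) w 1 = _
      rw [Finsupp.smul_single, smul_eq_mul, mul_one]
    rwa [e] at h

end TubeChoices

end

end TubeCone

theorem mainTheorem2 {C : Type*} [Category C] [Preadditive C] [Linear ℂ C]
    [MonoidalCategory C] [MonoidalPreadditive C] [MonoidalLinear ℂ C]
    [TubeCone.CStarTensorCategory C]
    (rigid : TubeCone.IsRigid C) (simple_unit : TubeCone.IsSimple (𝟙_ C))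
    (countable : Countable (TubeCone.Irr C)) :
    Nonempty (TubeCone.TubeChoices C) ∧
    ∀ D : TubeCone.TubeChoices C,
      (Function.Injective D.fusionToTube ∧
        LinearMap.range D.fusionToTube = D.corner .one .one ∧
        D.fusionToTube 1 = D.proj .one ∧
        (∀ a b : D.FusionAlgebra,
          D.fusionToTube (a * b) = D.fusionToTube a * D.fusionToTube b) ∧
        (∀ a : D.FusionAlgebra, D.fusionToTube (star a) = star (D.fusionToTube a))) ∧
      D.tubeCone ⊆ D.corner .one .one ∧
      TubeCone.IsSemiPreCStarAlgebra D.fusionCone := by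
  refine ⟨TubeCone.nonempty_tubeChoices rigid simple_unit, fun D => ⟨⟨?_, ?_, ?_, ?_, ?_⟩, ?_, ?_⟩⟩
  · exact D.fusionToTube_injective rigid simple_unit
  · exact D.range_fusionToTube rigid simple_unit
  · exact D.fusionToTube_one rigid simple_unit
  · exact D.fusionToTube_mul rigid simple_unit
  · exact D.fusionToTube_star rigid simple_unit
  · exact D.tubeCone_subset_corner
  · exact ⟨D.fusion_isUnitalStarAlgebra rigid simple_unit,
      D.fusionCone_isStarPositiveCone rigid simple_unit,
      D.boundedElements_fusionCone rigid simple_unit⟩
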